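/- **Model.** Let $s,d\ge 1$. For $t=1,\dots,s$ let $\mathcal X_t\subset\mathbb R^d$ be a finite set of $n_t$ design points, nested: $\mathcal X_t\subset\mathcal X_{t-1}$. Let $\mathbf y_t=y_t(\mathcal X_t)\in\mathbb R^{n_t}$ be the outputs of the level-$t$ code $y_t$ at these points, $\mathbf h_t$ a vector of basis functions, $\mathbf H_t=\mathbf h_t(\mathcal X_t)$, $\mathbf X_1=\mathbf H_1$, and $\mathbf X_t=[\mathbf H_t,\,y_{t-1}(\mathcal X_t)]$ for $t\ge2$; $q_t$ is the number of columns of $\mathbf X_t$ and $\mathcal C(\mathbf X_t)$ its column space. For $\phi=(\phi_{t,\ell})\in(0,\infty)^{sd}$ let $\mathbf R_{t,\ell}(\phi_{t,\ell})=\big[r_{t,\ell}(|x_\ell-x'_\ell|/\phi_{t,\ell})\big]_{x,x'\in\mathcal X_t}$, and let $\mathbf R_t$ be the entrywise product of $\mathbf R_{t,1},\dots,\mathbf R_{t,d}$, where each $r_{t,\ell}$ is a correlation function ($r_{t,\ell}(0)=1$, and $[r_{t,\ell}(|x_i-x_j|)]_{i,j}$ is positive definite for distinct reals $x_1,\dots,x_n$).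 Given the lower levels, $\mathbf y_t\sim\mathcal N(\mathbf X_t\mathbf b_t,\sigma_t^2\mathbf R_t)$ with $\mathbf b_t=(\beta_t,\gamma_{t-1})$ ($\mathbf b_1=\beta_1$); the likelihood $L$ is the product of these $s$ normal densities. The prior density of $(\mathbf b,\sigma^2,\phi)$ is $\pi(\phi)\prod_t(\sigma_t^2)^{-a_t}$, $a_t\in\mathbb R$. Assume that each $\mathbf X_t$ has full column rank and $\mathbf y_t\notin\mathcal C(\mathbf X_t)$. The integrated likelihood is, up to a positive constant factor, $$L^I(\phi\mid\mathbf y)=\prod_{t=1}^s|\mathbf R_t|^{-1/2}\,|\mathbf X_t^\top\mathbf R_t^{-1}\mathbf X_t|^{-1/2}\,\{S^2(\phi_t)\}^{-\left(\frac{n_t-q_t}{2}+a_t-1\right)},$$ where $S^2(\phi_t)=\mathbf y_t^\top\mathbf Q_t\mathbf y_t$ and $\mathbf Q_t=\mathbf R_t^{-1}\big(\mathbf I-\mathbf X_t(\mathbf X_t^\top\mathbf R_t^{-1}\mathbf X_t)^{-1}\mathbf X_t^\top\mathbf R_t^{-1}\big)$. **Assumption on the correlation functions.** For all $t,\ell$: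 for each $u>0$, $\varphi\mapsto r_{t,\ell}(u/\varphi)$ is continuous on $(0,\infty)$; $r_{t,\ell}(u)\to0$ as $u\to\infty$; and for all large $\varphi$ $$\mathbf R_{t,\ell}(\varphi)=\mathbf 1\mathbf 1^\top+\nu_{t,\ell}(\varphi)\mathbf D_{t,\ell}+\nu_{t,\ell}(\varphi)\,\omega_{t,\ell}(\varphi)\big(\mathbf D^*_{t,\ell}+\mathbf B_{t,\ell}(\varphi)\big),$$ where $\nu_{t,\ell}>0$ is continuous on $(0,\infty)$, $\mathbf D_{t,\ell}$ is a fixed nonsingular matrix with $\mathbf 1^\top\mathbf D_{t,\ell}^{-1}\mathbf 1\ne0$, $\mathbf D^*_{t,\ell}$ is a fixed matrix, $\nu_{t,\ell}$, $\omega_{t,\ell}$ and the entries of $\mathbf B_{t,\ell}$ are differentiable and $\omega_{t,\ell}\neq 0$ for all large $\varphi$, and as $\varphi\to\infty$, with $\|\mathbf B\|_\infty=\max_{i,j}|b_{ij}|$, $$\nu_{t,\ell}\to0,\quad \omega_{t,\ell}\to0,\quad \frac{\omega_{t,\ell}'}{(\log\nu_{t,\ell})'}\to0,\quad \|\mathbf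 B_{t,\ell}\|_\infty\to0,\quad \frac{\|\mathbf B_{t,\ell}'\|_\infty}{(\log|\omega_{t,\ell}|)'}\to0.$$ **Conclusions.** (0) If $\frac{n_t-q_t}{2}+a_t-1>0$ for all $t$, then there is a constant $C>0$, independent of $\phi$, such that for all $\phi\in(0,\infty)^{sd}$ the integral of $L\cdot\prod_t(\sigma_t^2)^{-a_t}$ over all $\mathbf b_t\in\mathbb R^{q_t}$ and $\sigma_t^2\in(0,\infty)$, $t=1,\dots,s$, equals $C\,L^I(\phi\mid\mathbf y)$. (i) For all real $a_t$: if $\phi^0\in[0,\infty)^{sd}$ has at least one coordinate equal to $0$, then $L^I(\phi\mid\mathbf y)$ has a finite, strictly positive limit as $\phi\to\phi^0$ within $(0,\infty)^{sd}$. In particular this holds when some $\phi_{t,\ell}\to0^+$ and the other components are fixed. (ii) For all real $a_t$: if moreover $\mathbf y_t\notin\mathcal C(\mathbf X_t)+\mathbb R\mathbf 1$ for every $t$, then, as $\phi_{t,\ell}\to\infty$ for all $t$ and $\ell$, $$L^I(\phi\mid\mathbf y)=O\Big(\prod_{t=1}^s\Big(\sum_{\ell=1}^d\nu_{t,\ell}(\phi_{t,\ell})\Big)^{a_t-c_t}\Big),\qquad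 c_t=\begin{cases}1,&\mathbf 1\in\mathcal C(\mathbf X_t),\\ \tfrac12,&\mathbf 1\notin\mathcal C(\mathbf X_t).\end{cases}$$ (iii) With $a_t=1$ for all $t$, both the flat prior $\pi(\phi)=1$ and the inverse-range prior $\pi(\phi)=\prod_{t,\ell}\phi_{t,\ell}^{-1}$ give improper posteriors: the integral of likelihood times prior over all parameters $(\mathbf b,\sigma^2,\phi)$, $\mathbf b_t\in\mathbb R^{q_t}$, $\sigma_t^2\in(0,\infty)$, $\phi\in(0,\infty)^{sd}$, is infinite. -/

import Mathlib

open Filter Topology MeasureTheory Asymptotics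
open scoped Matrix

noncomputable section

/-- A (strictly positive definite, isotropic) correlation function on the line: `r 0 = 1`, and for
pairwise distinct points `x 0, …, x (n-1)` the matrix `(r |x i - x j|)` is positive definite. -/
structure IsCorrelationFunction (r : ℝ → ℝ) : Prop where
  map_zero : r 0 = 1
  posDef : ∀ (n : ℕ) (x : Fin n → ℝ), Function.Injective x →
    (Matrix.of fun i j => r |x i - x j|).PosDef

/-- The correlation matrix of the one-dimensional points `x i` for the range parameter `φ`. -/
def corrMatrix {ι : Type*} (r : ℝ → ℝ) (x : ι → ℝ) (φ : ℝ) : Matrix ι ι ℝ :=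
  Matrix.of fun i j => r (|x i - x j| / φ)

/-- The largest absolute value of an entry of a matrix (the norm of `ι → ι → ℝ` is the sup norm). -/
def maxAbsEntry {ι : Type*} [Fintype ι] (A : Matrix ι ι ℝ) : ℝ :=
  ‖(fun i j => A i j : ι → ι → ℝ)‖

/-- The assumption on one correlation function `r`, for points with coordinates `x i` in
one input dimension: continuity in the range parameter, decay at infinity, and the expansion of
the correlation matrix for a large range parameter. -/
structure CorrelationAssumption {ι : Type*} [Fintype ι] [DecidableEq ι] (r : ℝ → ℝ) (x : ι → ℝ)
    (ν ω : ℝ → ℝ) (D Dstar : Matrix ι ι ℝ) (B : ℝ → Matrix ι ι ℝ) : Prop where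
  continuousOn : ∀ u : ℝ, 0 < u → ContinuousOn (fun φ => r (u / φ)) (Set.Ioi 0)
  tendsto_zero : Tendsto r atTop (𝓝 0)
  expansion : ∀ᶠ φ in atTop, corrMatrix r x φ =
    (Matrix.of fun _ _ => (1 : ℝ)) + ν φ • D + (ν φ * ω φ) • (Dstar + B φ)
  ν_pos : ∀ φ, 0 < φ → 0 < ν φ
  ν_continuousOn : ContinuousOn ν (Set.Ioi 0)
  D_nonsingular : IsUnit D.det
  D_one : (1 : ι → ℝ) ⬝ᵥ (D⁻¹ *ᵥ (1 : ι → ℝ)) ≠ 0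
  ν_differentiable : ∀ᶠ φ in atTop, DifferentiableAt ℝ ν φ
  ω_differentiable : ∀ᶠ φ in atTop, DifferentiableAt ℝ ω φ
  ω_ne_zero : ∀ᶠ φ in atTop, ω φ ≠ 0
  B_differentiable : ∀ i j, ∀ᶠ φ in atTop, DifferentiableAt ℝ (fun ψ => B ψ i j) φ
  ν_tendsto : Tendsto ν atTop (𝓝 0)
  ω_tendsto : Tendsto ω atTop (𝓝 0)
  ω_deriv : Tendsto (fun φ => deriv ω φ / deriv (fun ψ => Real.log (ν ψ)) φ) atTop (𝓝 0)
  B_tendsto : Tendsto (fun φ => maxAbsEntry (B φ)) atTop (𝓝 0)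
  B_deriv : Tendsto (fun φ => maxAbsEntry (Matrix.of fun i j => deriv (fun ψ => B ψ i j) φ) /
    deriv (fun ψ => Real.log (ω ψ)) φ) atTop (𝓝 0)

/-- Density at `y` of the multivariate normal distribution with mean `m` and covariance `C`. -/
def gaussianDensity {ι : Type*} [Fintype ι] [DecidableEq ι] (m : ι → ℝ) (C : Matrix ι ι ℝ)
    (y : ι → ℝ) : ℝ :=
  (2 * Real.pi) ^ (-(Fintype.card ι : ℝ) / 2) * C.det ^ (-(1 / 2) : ℝ) *
    Real.exp (-((y - m) ⬝ᵥ (C⁻¹ *ᵥ (y - m))) / 2)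

/-- The autoregressive cokriging model with `s` code levels on inputs in `ℝ^d`, together with its
data. Levels are numbered from `0`. -/
structure CokrigingModel (s d : ℕ) where
  /-- the set of inputs at which the code of level `t` is run -/
  design : Fin s → Finset (Fin d → ℝ)
  /-- the design is hierarchically nested -/
  nested : ∀ t u : Fin s, u.val + 1 = t.val → design t ⊆ design u
  /-- number of basis functions of level `t` -/
  p : Fin s → ℕ
  /-- vector of basis functions of level `t` -/
  h : (t : Fin s) → (Fin d → ℝ) → Fin (p t) → ℝ
  /-- code of level `t`; only its values at the design points of level `t` are data -/
  code : Fin s → (Fin d → ℝ) → ℝ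
  /-- correlation function of level `t` in input dimension `ℓ` -/
  r : Fin s → Fin d → ℝ → ℝ
  /-- they are correlation functions -/
  r_corr : ∀ t ℓ, IsCorrelationFunction (r t ℓ)

namespace CokrigingModel

variable {s d : ℕ} (M : CokrigingModel s d)

/-- Row indices of level `t`: the design points. -/
abbrev Row (t : Fin s) : Type := {x : Fin d → ℝ // x ∈ M.design t}

/-- Column indices of level `t`: the basis functions, and the preceding level if there is one. -/
abbrev Col (t : Fin s) : Type := Fin (M.p t) ⊕ {u : Fin s // u.val + 1 = t.val}

/-- Output vector of level `t`. -/
def y (t : Fin s) : M.Row t → ℝ := fun x => M.code t x.1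

/-- `X_1 = H_1`, and `X_t = [H_t, W_{t-1}]` with `W_{t-1}` the outputs of level `t - 1` at the
design points of level `t`. -/
def X (t : Fin s) : Matrix (M.Row t) (M.Col t) ℝ :=
  Matrix.of fun x => Sum.elim (fun k => M.h t x.1 k) (fun u => M.code u.1 x.1)

/-- Column space of `X_t`. -/
def colSpace (t : Fin s) : Submodule ℝ (M.Row t → ℝ) := LinearMap.range (M.X t).mulVecLin

/-- The correlation matrix of level `t`: entrywise product of those of the input dimensions. -/
def R (t : Fin s) (φ : Fin d → ℝ) : Matrix (M.Row t) (M.Row t) ℝ :=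
  Matrix.of fun i j => ∏ ℓ, corrMatrix (M.r t ℓ) (fun x : M.Row t => x.1 ℓ) (φ ℓ) i j

/-- Location-scale parameters: for each level `(b_t, σ_t²)`, where `b_t = (β_t, γ_{t-1})`. -/
abbrev LocScale : Type := (t : Fin s) → (M.Col t → ℝ) × ℝ

/-- The set of location-scale parameters with all variances positive. -/
def locScaleSet : Set M.LocScale := {θ | ∀ t, 0 < (θ t).2}

/-- The sampling density of the data: level `t` is normal with mean `X_t b_t = H_t β_t + W_{t-1}
γ_{t-1}` and covariance `σ_t² R_t`, given the preceding level. -/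
def likelihood (θ : M.LocScale) (φ : Fin s → Fin d → ℝ) : ℝ :=
  ∏ t, gaussianDensity (M.X t *ᵥ (θ t).1) ((θ t).2 • M.R t (φ t)) (M.y t)

/-- The integral of the likelihood against the prior `∏ (σ_t²)^(-a_t)` of the location-scale
parameters, for fixed correlation parameters. -/
def locScaleIntegral (a : Fin s → ℝ) (φ : Fin s → Fin d → ℝ) : ENNReal :=
  ∫⁻ θ in M.locScaleSet, ENNReal.ofReal (M.likelihood θ φ / ∏ t, (θ t).2 ^ a t)

/-- Total mass of the unnormalised posterior of all parameters, for the prior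
`π(φ) / ∏ (σ_t²)^(a_t)`. -/
def posteriorMass (a : Fin s → ℝ) (prior : (Fin s → Fin d → ℝ) → ℝ) : ENNReal :=
  ∫⁻ φ in {φ : Fin s → Fin d → ℝ | ∀ t ℓ, 0 < φ t ℓ}, ∫⁻ θ in M.locScaleSet,
    ENNReal.ofReal (M.likelihood θ φ * (prior φ / ∏ t, (θ t).2 ^ a t))

/-- The matrix `Q_t = R⁻¹ P` with `P = I - X (Xᵀ R⁻¹ X)⁻¹ Xᵀ R⁻¹`. -/
def Q (t : Fin s) (φ : Fin d → ℝ) : Matrix (M.Row t) (M.Row t) ℝ :=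
  (M.R t φ)⁻¹ * (1 - M.X t * ((M.X t)ᵀ * (M.R t φ)⁻¹ * M.X t)⁻¹ * (M.X t)ᵀ * (M.R t φ)⁻¹)

/-- `S²(φ_t) = y_tᵀ Q_t y_t`. -/
def S2 (t : Fin s) (φ : Fin d → ℝ) : ℝ := M.y t ⬝ᵥ (M.Q t φ *ᵥ M.y t)

/-- The number `(n_t - q_t) / 2 + a_t - 1`. -/
def expo (a : Fin s → ℝ) (t : Fin s) : ℝ :=
  ((Fintype.card (M.Row t) : ℝ) - (Fintype.card (M.Col t) : ℝ)) / 2 + a t - 1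

/-- The integrated likelihood of the correlation parameters (normalised to have constant `1`). -/
def integratedLikelihood (a : Fin s → ℝ) (φ : Fin s → Fin d → ℝ) : ℝ :=
  ∏ t, (M.R t (φ t)).det ^ (-(1 / 2) : ℝ) *
    ((M.X t)ᵀ * (M.R t (φ t))⁻¹ * M.X t).det ^ (-(1 / 2) : ℝ) * M.S2 t (φ t) ^ (-M.expo a t)

open Classical in
/-- `c_t = 1` if the all-ones vector lies in the column space of `X_t`, else `1/2`. -/
def c (t : Fin s) : ℝ := if (1 : M.Row t → ℝ) ∈ M.colSpace t then 1 else 1 / 2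

end CokrigingModel

end

/-! Each level enters L^I only through its correlation matrix R, which degenerates to 11ᵀ for large
ranges, where R⁻¹ blows up. Contrasts remove the inverse. Let the columns of K be a basis of C(X)^⊥,
and put m = n − q, G = KᵀRK, z = Kᵀy. Then |R||XᵀR⁻¹X| = c|G| with c independent of R, and S² =
zᵀG⁻¹z (`IsContrast.exists_det_mul_det`, `IsContrast.residual_eq`).

Large ranges. Let w = Σ ν_ℓ. The expansion forces each D_ℓ to be positive definite on 1^⊥
(`CorrelationAssumption.D_pos`), so by Finsler's lemma uᵀRu lies between (1·u)²/2 + aw|u|² and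
(1·u)² + bw|u|² (`exists_flatLike_prodCorr`). With v = Kᵀ1, the determinant |G| is at least of order
w^(m−1), or w^m if v = 0, that is, if 1 ∈ C(X). Moreover S² is at most of order 1/w, and of exactly
that order if z ∉ ℝv. Collecting powers gives (ii) (`exists_levelFactor_le`).

Conclusion (i) is continuity: R tends to the identity at a level where some range tends to 0 and to
a positive definite matrix at the others, and the level factor is continuous and positive on
positive definite matrices. Conclusion (0) is a Gaussian integral in b followed by an inverse-gamma
integral in σ².

Impropriety. For a_t = 1 the level factor is at least c w^(1/2). Positive definiteness at three
equally spaced points makes 1 − r(u) at least quadratic at 0, hence ν ≥ c/φ², and L^I dominates a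
multiple of ∏ 1/φ on an orthant far out. This defeats the flat prior. Under the inverse-range prior,
the positive limit of L^I at φ = 0 leaves the divergent integral of ∏ 1/φ near the origin. -/

section Matrices

variable {ι κ : Type} {X : Matrix ι κ ℝ}

theorem mulVec_injective_of_col [Fintype κ] (hX : LinearIndependent ℝ X.col) :
    Function.Injective X.mulVec := Matrix.mulVec_injective_iff.2 hX

theorem Matrix.PosDef.transpose_mul_mul [Fintype ι] [Fintype κ] {R : Matrix ι ι ℝ}
    (hR : R.PosDef) (hX : Function.Injective X.mulVec) : (Xᵀ * R * X).PosDef := by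
  simpa using hR.conjTranspose_mul_mul_same hX

theorem Matrix.PosDef.isUnit_det [Fintype ι] [DecidableEq ι] {R : Matrix ι ι ℝ}
    (hR : R.PosDef) : IsUnit R.det :=
  hR.det_pos.ne'.isUnit

theorem Matrix.PosDef.transpose_eq {R : Matrix ι ι ℝ} (hR : R.PosDef) : Rᵀ = R := by
  simpa using hR.isHermitian.eq

end Matrices

/-! ### Contrasts: eliminating the regression part. -/

/-- `K` is a matrix of contrasts for `X`: its columns form a basis of the orthogonal complement of
the column space of `X`. -/
structure IsContrast {ι κ : Type} [Fintype ι] [Fintype κ] {m : ℕ} (X : Matrix ι κ ℝ) (K : Matrix ι (Fin m) ℝ) : Prop where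
  card_eq : m + Fintype.card κ = Fintype.card ι
  transpose_mul : Kᵀ * X = 0
  mem_range : ∀ w, Kᵀ *ᵥ w = 0 → ∃ v, X *ᵥ v = w
  injective : Function.Injective K.mulVec

theorem IsContrast.transpose_mul' {ι κ : Type} [Fintype ι] [Fintype κ]
    {m : ℕ} {X : Matrix ι κ ℝ} {K : Matrix ι (Fin m) ℝ} (hK : IsContrast X K) : Xᵀ * K = 0 := by
  rw [← Matrix.transpose_inj]
  simpa using hK.transpose_mul

section Contrasts

variable {ι κ : Type} [Fintype ι] [DecidableEq ι] [Fintype κ] [DecidableEq κ]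

/-- Extend the columns of X to a basis of the whole space. Then Kᵀ reads off the coordinates along
the added vectors, so its kernel is the column space of X. -/
theorem exists_isContrast (X : Matrix ι κ ℝ) (hX : LinearIndependent ℝ X.col) :
    ∃ (m : ℕ) (K : Matrix ι (Fin m) ℝ), IsContrast X K := by
  classical
  let b := Module.Basis.sumExtend hX
  have hfin : Finite (κ ⊕ Module.Basis.sumExtendIndex hX) := Module.Finite.finite_basis b
  have : Finite (Module.Basis.sumExtendIndex hX) :=
    Finite.of_injective (Sum.inr : _ → κ ⊕ Module.Basis.sumExtendIndex hX) Sum.inr_injective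
  have : Fintype (Module.Basis.sumExtendIndex hX) := Fintype.ofFinite _
  let e := Fintype.equivFin (Module.Basis.sumExtendIndex hX)
  let f : (ι → ℝ) →ₗ[ℝ] (Fin (Fintype.card (Module.Basis.sumExtendIndex hX)) → ℝ) :=
    { toFun := fun w j => b.repr w (Sum.inr (e.symm j))
      map_add' := fun _ _ => by ext; simp
      map_smul' := fun _ _ => by ext; simp }
  have hb : ∀ i, b (Sum.inl i) = X.col i := by
    intro i
    simp only [b, Module.Basis.sumExtend, Equiv.trans_def, Module.Basis.coe_reindex,
      Function.comp_apply, Module.Basis.coe_extend]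
    rfl
  have hf : ∀ w, ((LinearMap.toMatrix' f)ᵀ)ᵀ *ᵥ w = f w := by
    intro w
    rw [Matrix.transpose_transpose]
    exact LinearMap.toMatrix'_mulVec f w
  refine ⟨_, (LinearMap.toMatrix' f)ᵀ, ⟨?_, ?_, ?_, ?_⟩⟩
  · have h1 := Module.finrank_eq_card_basis b
    simp only [Module.finrank_fintype_fun_eq_card] at h1
    rw [h1, Fintype.card_sum, add_comm]
  · ext j i
    have h1 : (((LinearMap.toMatrix' f)ᵀ)ᵀ * X) j i = (((LinearMap.toMatrix' f)ᵀ)ᵀ *ᵥ X.col i) j := rfl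
    rw [h1, hf, ← hb]
    simp [f]
  · intro w hw
    rw [hf] at hw
    refine ⟨fun i => b.repr w (Sum.inl i), ?_⟩
    have h1 : ∀ j, b.repr w (Sum.inr j) = 0 := fun j => by
      have := congrFun hw (e j)
      simpa [f] using this
    conv_rhs => rw [← b.sum_repr w]
    rw [Fintype.sum_sum_type]
    simp only [h1, zero_smul, Finset.sum_const_zero, add_zero, hb]
    ext i
    simp [Matrix.mulVec, dotProduct, Matrix.col, mul_comm]
  · rw [← Matrix.coe_mulVecLin, ← LinearMap.ker_eq_bot, LinearMap.ker_eq_bot']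
    intro u hu
    let w : ι → ℝ := ∑ j, u j • b (Sum.inr (e.symm j))
    have h1 : f w = u := by
      ext j
      simp [f, w, Finsupp.single_apply]
    have h2 : u ⬝ᵥ f w = 0 := by
      rw [← hf, Matrix.dotProduct_mulVec, Matrix.vecMul_transpose]
      rw [Matrix.mulVecLin_apply] at hu
      rw [hu, zero_dotProduct]
    rw [h1] at h2
    exact dotProduct_self_eq_zero.1 h2

variable {m : ℕ} {X : Matrix ι κ ℝ} {K : Matrix ι (Fin m) ℝ}

/-- The determinant of the contrasts' covariance, up to a constant factor. -/
theorem IsContrast.exists_det_mul_det (hK : IsContrast X K) (hX : LinearIndependent ℝ X.col) :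
    ∃ c : ℝ, 0 < c ∧ ∀ R : Matrix ι ι ℝ, R.PosDef →
      R.det * (Xᵀ * R⁻¹ * X).det = c * (Kᵀ * R * K).det := by
  have hX' := mulVec_injective_of_col hX
  let e : ι ≃ κ ⊕ Fin m := Fintype.equivOfCardEq (by
    rw [Fintype.card_sum, Fintype.card_fin, add_comm, hK.card_eq])
  let P : Matrix ι ι ℝ := (Matrix.fromCols X K).submatrix id e
  have key : ∀ R : Matrix ι ι ℝ, R.PosDef →
      R.det * (Xᵀ * R⁻¹ * X).det * P.det ^ 2 = (Xᵀ * X).det ^ 2 * (Kᵀ * R * K).det := by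
    intro R hR
    have hG := hR.transpose_mul_mul hK.injective
    -- T = [X, RK]: the product TᵀR⁻¹T is block diagonal, and PᵀT with P = [X, K] is block
    -- triangular. Eliminating det T from the two determinant identities gives the claim.
    let T : Matrix ι ι ℝ := (Matrix.fromCols X (R * K)).submatrix id e
    have h1 : T.det ^ 2 = R.det * ((Xᵀ * R⁻¹ * X).det * (Kᵀ * R * K).det) := by
      have h : Tᵀ * R⁻¹ * T =
          (Matrix.fromBlocks (Xᵀ * R⁻¹ * X) 0 0 (Kᵀ * R * K)).submatrix e e := by
        have : Tᵀ * R⁻¹ * T = ((Matrix.fromCols X (R * K))ᵀ * R⁻¹ *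
          (Matrix.fromCols X (R * K))).submatrix e e := rfl
        rw [this, Matrix.transpose_fromCols, Matrix.fromRows_mul, Matrix.fromRows_mul_fromCols,
          Matrix.transpose_mul, hR.transpose_eq]
        congr 2
        · rw [Matrix.mul_assoc, ← Matrix.mul_assoc R⁻¹, Matrix.nonsing_inv_mul _ hR.isUnit_det,
            Matrix.one_mul, hK.transpose_mul']
        · rw [Matrix.mul_assoc Kᵀ, Matrix.mul_nonsing_inv _ hR.isUnit_det, Matrix.mul_one,
            hK.transpose_mul]
        · rw [Matrix.mul_assoc Kᵀ, Matrix.mul_nonsing_inv _ hR.isUnit_det, Matrix.mul_one,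
            Matrix.mul_assoc]
      have h' := congrArg Matrix.det h
      rw [Matrix.det_submatrix_equiv_self, Matrix.det_fromBlocks_zero₂₁, Matrix.det_mul,
        Matrix.det_mul, Matrix.det_transpose, Matrix.det_nonsing_inv, Ring.inverse_eq_inv'] at h'
      rw [← h']
      field_simp [hR.det_pos.ne']
    have h2 : P.det * T.det = (Xᵀ * X).det * (Kᵀ * R * K).det := by
      have h : Pᵀ * T =
          (Matrix.fromBlocks (Xᵀ * X) (Xᵀ * (R * K)) 0 (Kᵀ * R * K)).submatrix e e := by
        have : Pᵀ * T = ((Matrix.fromCols X K)ᵀ *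
          (Matrix.fromCols X (R * K))).submatrix e e := rfl
        rw [this, Matrix.transpose_fromCols, Matrix.fromRows_mul_fromCols, hK.transpose_mul,
          Matrix.mul_assoc]
      have h' := congrArg Matrix.det h
      rwa [Matrix.det_submatrix_equiv_self, Matrix.det_fromBlocks_zero₂₁, Matrix.det_mul,
        Matrix.det_transpose] at h'
    apply mul_right_cancel₀ hG.det_pos.ne'
    calc R.det * (Xᵀ * R⁻¹ * X).det * P.det ^ 2 * (Kᵀ * R * K).det
        = T.det ^ 2 * P.det ^ 2 := by rw [h1]; ring
      _ = (P.det * T.det) ^ 2 := by ring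
      _ = _ := by rw [h2]; ring
  have hXX : 0 < (Xᵀ * X).det := by
    have := (Matrix.PosDef.one (n := ι) (R := ℝ)).transpose_mul_mul hX'
    simpa using this.det_pos
  -- The identity just proved, taken at R = 1, has a positive right side.
  have hP : P.det ≠ 0 := by
    intro h0
    have h := key 1 Matrix.PosDef.one
    rw [h0] at h
    have h2 := ((Matrix.PosDef.one (n := ι) (R := ℝ)).transpose_mul_mul hK.injective).det_pos
    have h3 : 0 < (Xᵀ * X).det ^ 2 * (Kᵀ * (1 : Matrix ι ι ℝ) * K).det := by positivity
    rw [← h] at h3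
    simp at h3
  refine ⟨(Xᵀ * X).det ^ 2 / P.det ^ 2, by positivity, fun R hR => ?_⟩
  have := key R hR
  field_simp
  linarith

/-- The generalised residual sum of squares in terms of contrasts. -/
theorem IsContrast.residual_eq (hK : IsContrast X K) (hX : LinearIndependent ℝ X.col)
    {R : Matrix ι ι ℝ} (hR : R.PosDef) (y : ι → ℝ) :
    y ⬝ᵥ ((R⁻¹ * (1 - X * (Xᵀ * R⁻¹ * X)⁻¹ * Xᵀ * R⁻¹)) *ᵥ y) =
      (Kᵀ *ᵥ y) ⬝ᵥ ((Kᵀ * R * K)⁻¹ *ᵥ (Kᵀ *ᵥ y)) := by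
  have hG := hR.transpose_mul_mul hK.injective
  have hA := hR.inv.transpose_mul_mul (mulVec_injective_of_col hX)
  set A := Xᵀ * R⁻¹ * X with hAdef
  set G := Kᵀ * R * K with hGdef
  set Q := R⁻¹ * (1 - X * A⁻¹ * Xᵀ * R⁻¹) with hQ
  have hQX : Q * X = 0 := by
    have : Q * X = R⁻¹ * (X - X * (A⁻¹ * A)) := by
      simp only [hQ, hAdef, Matrix.mul_sub, Matrix.sub_mul, Matrix.mul_assoc, Matrix.one_mul]
    rw [this, Matrix.nonsing_inv_mul _ hA.isUnit_det]
    simp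
  have hQK : Q * (R * K) = K := by
    have : Q * (R * K) = R⁻¹ * R * K - R⁻¹ * X * A⁻¹ * Xᵀ * (R⁻¹ * R) * K := by
      simp only [hQ, Matrix.mul_sub, Matrix.sub_mul, Matrix.mul_assoc, Matrix.one_mul]
    rw [this, Matrix.nonsing_inv_mul _ hR.isUnit_det]
    simp [Matrix.mul_assoc, hK.transpose_mul']
  -- This b makes y − RKb a vector of C(X). Since Q annihilates X and sends RK to K, it follows that
  -- Qy = Kb.
  set b := G⁻¹ *ᵥ (Kᵀ *ᵥ y) with hb
  have hGb : G *ᵥ b = Kᵀ *ᵥ y := by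
    rw [hb, Matrix.mulVec_mulVec, Matrix.mul_nonsing_inv _ hG.isUnit_det, Matrix.one_mulVec]
  obtain ⟨v, hv⟩ := hK.mem_range (y - (R * K) *ᵥ b) (by
    rw [Matrix.mulVec_sub, Matrix.mulVec_mulVec, ← Matrix.mul_assoc, hGb, sub_self])
  have hy : y = X *ᵥ v + (R * K) *ᵥ b := by rw [hv]; abel
  have hQy : Q *ᵥ y = K *ᵥ b := by
    conv_lhs => rw [hy]
    rw [Matrix.mulVec_add, Matrix.mulVec_mulVec, Matrix.mulVec_mulVec, hQX, hQK]
    simp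
  rw [hQy, Matrix.dotProduct_mulVec, ← Matrix.mulVec_transpose]

end Contrasts

/-! ### Quadratic forms: coercivity and comparison of determinants. -/

section QuadraticForms

variable {ι : Type} [Fintype ι]

theorem dotProduct_self_pos {u : ι → ℝ} (hu : u ≠ 0) : 0 < u ⬝ᵥ u := by
  refine lt_of_le_of_ne ?_ (fun h => hu (dotProduct_self_eq_zero.1 h.symm))
  exact Finset.sum_nonneg fun _ _ => mul_self_nonneg _

theorem dotProduct_self_nonneg' (u : ι → ℝ) : 0 ≤ u ⬝ᵥ u :=
  Finset.sum_nonneg fun _ _ => mul_self_nonneg _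

/-- Finsler's lemma: a quadratic form that is positive on the kernel of `c` becomes positive after
adding a large multiple of `(c ⬝ᵥ u)²`. -/
theorem finsler (D : Matrix ι ι ℝ) (c : ι → ℝ)
    (h : ∀ z, z ≠ 0 → c ⬝ᵥ z = 0 → 0 < z ⬝ᵥ (D *ᵥ z)) :
    ∀ᶠ k : ℕ in atTop, ∀ u : ι → ℝ,
      1 / ((k : ℝ) + 1) * (u ⬝ᵥ u) ≤ u ⬝ᵥ (D *ᵥ u) + k * (c ⬝ᵥ u) ^ 2 := by
  -- One index serves both as the penalty k and, through 1/(k+1), as the coercivity constant. The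
  -- open sets U k then increase with k, and compactness of the unit sphere yields a single k.
  let U : ℕ → Set (ι → ℝ) := fun k =>
    {u | 1 / ((k : ℝ) + 1) * (u ⬝ᵥ u) < u ⬝ᵥ (D *ᵥ u) + k * (c ⬝ᵥ u) ^ 2}
  have hmono : Monotone U := by
    intro k l hkl u hu
    simp only [U, Set.mem_ofPred_eq] at hu ⊢
    have hkl' : (k : ℝ) ≤ l := by exact_mod_cast hkl
    have h1 : 1 / ((l : ℝ) + 1) * (u ⬝ᵥ u) ≤ 1 / ((k : ℝ) + 1) * (u ⬝ᵥ u) := by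
      have := dotProduct_self_nonneg' u
      gcongr
    have h2 : (k : ℝ) * (c ⬝ᵥ u) ^ 2 ≤ l * (c ⬝ᵥ u) ^ 2 := by gcongr
    linarith
  have hopen : ∀ k, IsOpen (U k) := fun k => by
    apply isOpen_lt
    · exact continuous_const.mul (continuous_id.dotProduct continuous_id)
    · exact (continuous_id.dotProduct (continuous_const.matrix_mulVec continuous_id)).add
        (continuous_const.mul ((continuous_const.dotProduct continuous_id).pow 2))
  have hcover : Metric.sphere (0 : ι → ℝ) 1 ⊆ ⋃ k, U k := by
    intro u hu
    have hu0 : u ≠ 0 := by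
      rintro rfl
      simp at hu
    have hs := dotProduct_self_pos hu0
    rw [Set.mem_iUnion]
    have hT : Tendsto (fun k : ℕ => 1 / ((k : ℝ) + 1) * (u ⬝ᵥ u)) atTop (𝓝 (0 * (u ⬝ᵥ u))) :=
      tendsto_one_div_add_atTop_nhds_zero_nat.mul_const _
    rw [zero_mul] at hT
    by_cases hc : c ⬝ᵥ u = 0
    · obtain ⟨k, hk⟩ := (hT.eventually (gt_mem_nhds (h u hu0 hc))).exists
      refine ⟨k, ?_⟩
      simpa [U, hc] using hk
    · have h2 : Tendsto (fun k : ℕ => u ⬝ᵥ (D *ᵥ u) + k * (c ⬝ᵥ u) ^ 2) atTop atTop :=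
        tendsto_atTop_add_const_left _ _
          (tendsto_natCast_atTop_atTop.atTop_mul_const (by positivity))
      obtain ⟨k, hk1, hk2⟩ := ((hT.eventually (gt_mem_nhds one_pos)).and
        (h2.eventually_ge_atTop 1)).exists
      exact ⟨k, lt_of_lt_of_le hk1 hk2⟩
  obtain ⟨k, hk⟩ := (isCompact_sphere (0 : ι → ℝ) 1).elim_directed_cover U hopen hcover
    hmono.directed_le
  filter_upwards [eventually_ge_atTop k] with l hl u
  by_cases hu : u = 0
  · subst hu
    simp
  have hn : 0 < ‖u‖ := norm_pos_iff.2 hu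
  have hm : ‖u‖⁻¹ • u ∈ U l := hmono hl (hk (by
    rw [mem_sphere_zero_iff_norm, norm_smul, norm_inv, norm_norm, inv_mul_cancel₀ hn.ne']))
  simp only [U, Set.mem_ofPred_eq, Matrix.mulVec_smul, dotProduct_smul, smul_dotProduct,
    smul_eq_mul] at hm
  have h3 := mul_le_mul_of_nonneg_left hm.le (sq_nonneg ‖u‖)
  have e1 : ‖u‖ ^ 2 * (1 / ((l : ℝ) + 1) * (‖u‖⁻¹ * (‖u‖⁻¹ * (u ⬝ᵥ u)))) =
      1 / ((l : ℝ) + 1) * (u ⬝ᵥ u) := by field_simp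
  have e2 : ‖u‖ ^ 2 * (‖u‖⁻¹ * (‖u‖⁻¹ * (u ⬝ᵥ (D *ᵥ u))) + (l : ℝ) * (‖u‖⁻¹ * (c ⬝ᵥ u)) ^ 2) =
      u ⬝ᵥ (D *ᵥ u) + l * (c ⬝ᵥ u) ^ 2 := by field_simp
  rwa [e1, e2] at h3

theorem Matrix.PosDef.dotProduct_pos {A : Matrix ι ι ℝ} (hA : A.PosDef) {u : ι → ℝ}
    (hu : u ≠ 0) : 0 < u ⬝ᵥ (A *ᵥ u) := by
  simpa using hA.dotProduct_mulVec_pos hu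

theorem Matrix.PosDef.exists_mul_le {A : Matrix ι ι ℝ} (hA : A.PosDef) :
    ∃ κ : ℝ, 0 < κ ∧ ∀ u, κ * (u ⬝ᵥ u) ≤ u ⬝ᵥ (A *ᵥ u) := by
  obtain ⟨k, hk⟩ := (finsler A 0 (fun z hz _ => hA.dotProduct_pos hz)).exists
  exact ⟨1 / ((k : ℝ) + 1), by positivity, by simpa using hk⟩

theorem abs_dotProduct_mulVec_le {E : Matrix ι ι ℝ} {ε : ℝ} (hE : ∀ i j, |E i j| ≤ ε)
    (u : ι → ℝ) : |u ⬝ᵥ (E *ᵥ u)| ≤ ε * Fintype.card ι * (u ⬝ᵥ u) := by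
  by_cases hι : Nonempty ι
  swap
  · rw [not_nonempty_iff] at hι
    simp
  have hε : 0 ≤ ε := (abs_nonneg _).trans (hE hι.some hι.some)
  have h1 : |u ⬝ᵥ (E *ᵥ u)| ≤ ∑ i, ∑ j, ε * (|u i| * |u j|) := by
    refine (Finset.abs_sum_le_sum_abs _ _).trans (Finset.sum_le_sum fun i _ => ?_)
    rw [Matrix.mulVec, dotProduct, Finset.mul_sum]
    refine (Finset.abs_sum_le_sum_abs _ _).trans (Finset.sum_le_sum fun j _ => ?_)
    rw [abs_mul, abs_mul]
    have := mul_le_mul_of_nonneg_right (hE i j) (mul_nonneg (abs_nonneg (u i)) (abs_nonneg (u j)))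
    linarith
  have h2 : ∑ i, ∑ j, ε * (|u i| * |u j|) = ε * (∑ i, |u i|) ^ 2 := by
    simp_rw [← Finset.mul_sum, ← Finset.sum_mul]
    ring
  have h3 : (∑ i, |u i|) ^ 2 ≤ Fintype.card ι * ∑ i, |u i| ^ 2 :=
    sq_sum_le_card_mul_sum_sq
  have h4 : u ⬝ᵥ u = ∑ i, |u i| ^ 2 := by simp [dotProduct, sq]
  rw [h4]
  calc _ ≤ ε * (∑ i, |u i|) ^ 2 := h1.trans h2.le
    _ ≤ ε * (Fintype.card ι * ∑ i, |u i| ^ 2) := by gcongr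
    _ = _ := by ring

variable [DecidableEq ι]

theorem Matrix.PosDef.exists_eq_transpose_mul_self {A : Matrix ι ι ℝ} (hA : A.PosDef) :
    ∃ C : Matrix ι ι ℝ, A = Cᵀ * C ∧ C.det ≠ 0 := by
  open scoped MatrixOrder in
  obtain ⟨C, hC⟩ := CStarAlgebra.nonneg_iff_eq_star_mul_self.mp hA.posSemidef.nonneg
  rw [Matrix.star_eq_conjTranspose, Matrix.conjTranspose_eq_transpose_of_trivial] at hC
  refine ⟨C, hC, fun h => hA.det_pos.ne' ?_⟩
  rw [hC, Matrix.det_mul, h, mul_zero]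

/-- Every eigenvalue is at least 1, as testing on an eigenvector shows. -/
theorem one_le_det {A : Matrix ι ι ℝ} (hA : A.PosDef)
    (h : ∀ u, u ⬝ᵥ u ≤ u ⬝ᵥ (A *ᵥ u)) : 1 ≤ A.det := by
  rw [hA.isHermitian.det_eq_prod_eigenvalues]
  rw [← Finset.prod_const_one (s := (Finset.univ : Finset ι)) (M := ℝ)]
  refine Finset.prod_le_prod (fun _ _ => zero_le_one) fun i _ => ?_
  have hv := hA.isHermitian.mulVec_eigenvectorBasis i
  set v : ι → ℝ := ⇑(hA.isHermitian.eigenvectorBasis i) with hvdef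
  have hv0 : v ≠ 0 := by
    intro h0
    have := hA.isHermitian.eigenvectorBasis.orthonormal.ne_zero i
    apply this
    ext j
    exact congrFun h0 j
  have h1 := h v
  rw [hv, dotProduct_smul, smul_eq_mul] at h1
  have := dotProduct_self_pos hv0
  simp only [RCLike.ofReal_real_eq_id, id_eq]
  nlinarith

/-- Congruence by C⁻¹, where A = CᵀC, reduces the comparison to A = 1. -/
theorem Matrix.PosDef.det_le_det {A B : Matrix ι ι ℝ} (hA : A.PosDef) (hB : B.PosDef)
    (h : ∀ u, u ⬝ᵥ (A *ᵥ u) ≤ u ⬝ᵥ (B *ᵥ u)) : A.det ≤ B.det := by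
  obtain ⟨C, hC, hC0⟩ := hA.exists_eq_transpose_mul_self
  have hCu : IsUnit C.det := hC0.isUnit
  have hinj : Function.Injective (C⁻¹).mulVec :=
    Matrix.mulVec_injective_iff_isUnit.2 ((Matrix.isUnit_nonsing_inv_iff).2
      ((Matrix.isUnit_iff_isUnit_det _).2 hCu))
  have hP : ((C⁻¹)ᵀ * B * C⁻¹).PosDef := hB.transpose_mul_mul hinj
  have h1 := one_le_det hP (fun u => by
    have e1 : ∀ M : Matrix ι ι ℝ, u ⬝ᵥ (((C⁻¹)ᵀ * M * C⁻¹) *ᵥ u) =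
        (C⁻¹ *ᵥ u) ⬝ᵥ (M *ᵥ (C⁻¹ *ᵥ u)) := by
      intro M
      rw [← Matrix.mulVec_mulVec, ← Matrix.mulVec_mulVec, Matrix.dotProduct_mulVec,
        Matrix.vecMul_transpose]
    have e2 : (C⁻¹)ᵀ * A * C⁻¹ = 1 := by
      rw [hC, ← Matrix.mul_assoc, ← Matrix.transpose_mul, Matrix.mul_nonsing_inv _ hCu,
        Matrix.transpose_one, Matrix.one_mul, Matrix.mul_nonsing_inv _ hCu]
    have h2 := h (C⁻¹ *ᵥ u)
    rw [← e1, ← e1, e2, Matrix.one_mulVec] at h2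
    exact h2)
  rw [Matrix.det_mul, Matrix.det_mul, Matrix.det_transpose, Matrix.det_nonsing_inv,
    Ring.inverse_eq_inv'] at h1
  have h2 : A.det = C.det ^ 2 := by rw [hC, Matrix.det_mul, Matrix.det_transpose, sq]
  have h3 : 0 < C.det ^ 2 := by positivity
  rw [h2]
  calc C.det ^ 2 ≤ C.det ^ 2 * (C.det⁻¹ * B.det * C.det⁻¹) := by nlinarith
    _ = B.det := by field_simp

/-- With x = G⁻¹z, coercivity and Cauchy–Schwarz give a|x|² ≤ z·x ≤ |z||x|. -/
theorem Matrix.PosDef.dotProduct_inv_le {G : Matrix ι ι ℝ} (hG : G.PosDef) {a : ℝ} (ha : 0 < a)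
    (h : ∀ u, a * (u ⬝ᵥ u) ≤ u ⬝ᵥ (G *ᵥ u)) (z : ι → ℝ) :
    z ⬝ᵥ (G⁻¹ *ᵥ z) ≤ (z ⬝ᵥ z) / a := by
  set x := G⁻¹ *ᵥ z with hx
  have hGx : G *ᵥ x = z := by
    rw [hx, Matrix.mulVec_mulVec, Matrix.mul_nonsing_inv _ hG.isUnit_det, Matrix.one_mulVec]
  have h1 := h x
  rw [hGx, dotProduct_comm x z] at h1
  have h2 : (z ⬝ᵥ x) ^ 2 ≤ (z ⬝ᵥ z) * (x ⬝ᵥ x) := by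
    simpa [dotProduct, sq] using Finset.sum_mul_sq_le_sq_mul_sq Finset.univ z x
  rw [le_div_iff₀ ha]
  by_cases hz : z ⬝ᵥ x ≤ 0
  · have := dotProduct_self_nonneg' z
    nlinarith
  · push Not at hz
    have h3 := dotProduct_self_nonneg' z
    have : (z ⬝ᵥ x) * ((z ⬝ᵥ x) * a) ≤ (z ⬝ᵥ x) * (z ⬝ᵥ z) := by nlinarith
    exact le_of_mul_le_mul_left this hz

/-- Cauchy–Schwarz in the inner product defined by G, for the vectors u and G⁻¹z. -/
theorem Matrix.PosDef.sq_dotProduct_le {G : Matrix ι ι ℝ} (hG : G.PosDef) (u z : ι → ℝ) :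
    (u ⬝ᵥ z) ^ 2 ≤ (u ⬝ᵥ (G *ᵥ u)) * (z ⬝ᵥ (G⁻¹ *ᵥ z)) := by
  obtain ⟨C, hC, hC0⟩ := hG.exists_eq_transpose_mul_self
  set x := G⁻¹ *ᵥ z with hx
  have hGx : G *ᵥ x = z := by
    rw [hx, Matrix.mulVec_mulVec, Matrix.mul_nonsing_inv _ hG.isUnit_det, Matrix.one_mulVec]
  have e : ∀ a b : ι → ℝ, a ⬝ᵥ (G *ᵥ b) = (C *ᵥ a) ⬝ᵥ (C *ᵥ b) := by
    intro a b
    rw [hC, ← Matrix.mulVec_mulVec, Matrix.dotProduct_mulVec, Matrix.vecMul_transpose]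
  rw [dotProduct_comm z x, ← hGx, e, e, e]
  simpa [dotProduct, sq] using Finset.sum_mul_sq_le_sq_mul_sq Finset.univ (C *ᵥ u) (C *ᵥ x)

/-- Matrix determinant lemma. These are the comparison matrices for the contrasts' covariance: as a
→ 0, one eigenvalue stays of order 1 when b and v are nonzero, and the others equal a. -/
theorem det_smul_one_add_vecMulVec [Nonempty ι] {a : ℝ} (ha : a ≠ 0) (b : ℝ) (v : ι → ℝ) :
    (a • (1 : Matrix ι ι ℝ) + b • Matrix.vecMulVec v v).det =
      a ^ (Fintype.card ι - 1) * (a + b * (v ⬝ᵥ v)) := by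
  have h1 : a • (1 : Matrix ι ι ℝ) + b • Matrix.vecMulVec v v =
      a • (1 + Matrix.replicateCol Unit ((b / a) • v) * Matrix.replicateRow Unit v) := by
    ext i j
    simp [Matrix.vecMulVec_apply, Matrix.mul_apply]
    field_simp
  have h2 : Fintype.card ι = Fintype.card ι - 1 + 1 := (Nat.sub_add_cancel Fintype.card_pos).symm
  rw [h1, Matrix.det_smul, Matrix.det_one_add_replicateCol_mul_replicateRow]
  conv_lhs => rw [h2]
  rw [pow_succ, dotProduct_smul, smul_eq_mul]
  field_simp

theorem posDef_smul_one_add_vecMulVec {a b : ℝ} (ha : 0 < a) (hb : 0 ≤ b) (v : ι → ℝ) :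
    (a • (1 : Matrix ι ι ℝ) + b • Matrix.vecMulVec v v).PosDef := by
  refine (Matrix.PosDef.one.smul ha).add_posSemidef (Matrix.PosSemidef.smul ?_ hb)
  simpa using Matrix.posSemidef_vecMulVec_self_star v

theorem dotProduct_smul_one_add_vecMulVec (a b : ℝ) (v u : ι → ℝ) :
    u ⬝ᵥ ((a • (1 : Matrix ι ι ℝ) + b • Matrix.vecMulVec v v) *ᵥ u) =
      a * (u ⬝ᵥ u) + b * (v ⬝ᵥ u) ^ 2 := by
  have : Matrix.vecMulVec v v *ᵥ u = (v ⬝ᵥ u) • v := by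
    ext i
    simp [Matrix.mulVec, dotProduct, Matrix.vecMulVec_apply, Finset.sum_mul]
    exact Finset.sum_congr rfl fun _ _ => by ring
  rw [Matrix.add_mulVec, Matrix.smul_mulVec, Matrix.smul_mulVec, Matrix.one_mulVec, this,
    dotProduct_add, dotProduct_smul, dotProduct_smul, dotProduct_smul, dotProduct_comm u v]
  simp only [smul_eq_mul]
  ring

end QuadraticForms

/-! ### The factor of one level: positivity, continuity, and bounds near the flat limit. -/

section LevelFactor

variable {ι κ : Type} [Fintype ι] [DecidableEq ι] [Fintype κ] [DecidableEq κ]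

/-- The generalised residual sum of squares of `y` on `X` for the correlation matrix `R`. -/
noncomputable def residualForm (X : Matrix ι κ ℝ) (y : ι → ℝ) (R : Matrix ι ι ℝ) : ℝ :=
  y ⬝ᵥ ((R⁻¹ * (1 - X * (Xᵀ * R⁻¹ * X)⁻¹ * Xᵀ * R⁻¹)) *ᵥ y)

/-- The contribution of one level to the integrated likelihood, with exponent `e`. -/
noncomputable def levelFactor (X : Matrix ι κ ℝ) (y : ι → ℝ) (e : ℝ) (R : Matrix ι ι ℝ) : ℝ :=
  R.det ^ (-(1 / 2) : ℝ) * (Xᵀ * R⁻¹ * X).det ^ (-(1 / 2) : ℝ) * residualForm X y R ^ (-e)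

set_option linter.unusedSectionVars false

variable {X : Matrix ι κ ℝ} {y : ι → ℝ}

theorem IsContrast.ne_zero {m : ℕ} {K : Matrix ι (Fin m) ℝ} (hK : IsContrast X K)
    (hy : y ∉ LinearMap.range X.mulVecLin) : Kᵀ *ᵥ y ≠ 0 := by
  intro h
  obtain ⟨v, hv⟩ := hK.mem_range y h
  exact hy ⟨v, hv⟩

theorem residualForm_pos (hX : LinearIndependent ℝ X.col) (hy : y ∉ LinearMap.range X.mulVecLin)
    {R : Matrix ι ι ℝ} (hR : R.PosDef) : 0 < residualForm X y R := by
  obtain ⟨m, K, hK⟩ := exists_isContrast X hX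
  rw [residualForm, hK.residual_eq hX hR]
  exact (hR.transpose_mul_mul hK.injective).inv.dotProduct_pos (hK.ne_zero hy)

theorem levelFactor_pos (hX : LinearIndependent ℝ X.col) (hy : y ∉ LinearMap.range X.mulVecLin)
    (e : ℝ) {R : Matrix ι ι ℝ} (hR : R.PosDef) : 0 < levelFactor X y e R := by
  have h1 := hR.det_pos
  have h2 := (hR.inv.transpose_mul_mul (mulVec_injective_of_col hX)).det_pos
  have h3 := residualForm_pos hX hy hR
  rw [levelFactor]
  positivity

theorem continuousAt_inv_of_det_ne_zero {ι : Type} [Fintype ι] [DecidableEq ι] {R : Matrix ι ι ℝ} (hR : R.det ≠ 0) :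
    ContinuousAt (fun A : Matrix ι ι ℝ => A⁻¹) R := by
  simp only [Matrix.inv_def, Ring.inverse_eq_inv']
  exact ((continuous_id.matrix_det.continuousAt).inv₀ hR).smul
    continuous_id.matrix_adjugate.continuousAt

theorem continuousAt_gram_inv {R : Matrix ι ι ℝ} (hR : R.PosDef) :
    ContinuousAt (fun A : Matrix ι ι ℝ => Xᵀ * A⁻¹ * X) R := by
  have c : Continuous fun B : Matrix ι ι ℝ => Xᵀ * B * X :=
    (continuous_const.matrix_mul continuous_id).matrix_mul continuous_const
  exact Tendsto.comp (c.tendsto R⁻¹) (continuousAt_inv_of_det_ne_zero hR.det_pos.ne')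

theorem continuous_residual_aux (X : Matrix ι κ ℝ) (y : ι → ℝ) :
    Continuous fun p : Matrix ι ι ℝ × Matrix κ κ ℝ =>
      y ⬝ᵥ ((p.1 * (1 - X * p.2 * Xᵀ * p.1)) *ᵥ y) :=
  continuous_const.dotProduct ((continuous_fst.matrix_mul (continuous_const.sub
    (((continuous_const.matrix_mul continuous_snd).matrix_mul continuous_const).matrix_mul
      continuous_fst))).matrix_mulVec continuous_const)

theorem continuousAt_residualForm (hX : LinearIndependent ℝ X.col) {R : Matrix ι ι ℝ}
    (hR : R.PosDef) : ContinuousAt (residualForm X y) R := by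
  have hA := hR.inv.transpose_mul_mul (mulVec_injective_of_col hX)
  have h3 : ContinuousAt (fun A : Matrix ι ι ℝ => (Xᵀ * A⁻¹ * X)⁻¹) R :=
    Tendsto.comp (continuousAt_inv_of_det_ne_zero hA.det_pos.ne') (continuousAt_gram_inv hR)
  have h4 := (continuousAt_inv_of_det_ne_zero hR.det_pos.ne').prodMk h3
  have h5 := ((continuous_residual_aux X y).tendsto (R⁻¹, (Xᵀ * R⁻¹ * X)⁻¹)).comp h4.tendsto
  exact h5

theorem continuousAt_levelFactor (hX : LinearIndependent ℝ X.col)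
    (hy : y ∉ LinearMap.range X.mulVecLin) (e : ℝ) {R : Matrix ι ι ℝ} (hR : R.PosDef) :
    ContinuousAt (levelFactor X y e) R := by
  have hA := hR.inv.transpose_mul_mul (mulVec_injective_of_col hX)
  have c : Continuous fun B : Matrix κ κ ℝ => B.det := continuous_id.matrix_det
  have c' : Continuous fun B : Matrix ι ι ℝ => B.det := continuous_id.matrix_det
  have h5 : ContinuousAt (fun A : Matrix ι ι ℝ => (Xᵀ * A⁻¹ * X).det) R :=
    Tendsto.comp (c.tendsto (Xᵀ * R⁻¹ * X)) (continuousAt_gram_inv hR)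
  exact ((c'.continuousAt.rpow_const (Or.inl hR.det_pos.ne')).mul
    (h5.rpow_const (Or.inl hA.det_pos.ne'))).mul
    ((continuousAt_residualForm hX hR).rpow_const (Or.inl (residualForm_pos hX hy hR).ne'))

/-- The form in which the flat limit is analysed: R enters only through KᵀRK. -/
theorem IsContrast.exists_levelFactor_eq {m : ℕ} {K : Matrix ι (Fin m) ℝ} (hK : IsContrast X K)
    (hX : LinearIndependent ℝ X.col) :
    ∃ c : ℝ, 0 < c ∧ ∀ (e : ℝ) (R : Matrix ι ι ℝ), R.PosDef → levelFactor X y e R =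
      c * (Kᵀ * R * K).det ^ (-(1 / 2) : ℝ) *
        ((Kᵀ *ᵥ y) ⬝ᵥ ((Kᵀ * R * K)⁻¹ *ᵥ (Kᵀ *ᵥ y))) ^ (-e) := by
  obtain ⟨c, hc, h⟩ := hK.exists_det_mul_det hX
  refine ⟨c ^ (-(1 / 2) : ℝ), by positivity, fun e R hR => ?_⟩
  have hA := hR.inv.transpose_mul_mul (mulVec_injective_of_col hX)
  rw [levelFactor, residualForm, hK.residual_eq hX hR, ← Real.mul_rpow hR.det_pos.le hA.det_pos.le,
    h R hR, Real.mul_rpow hc.le (hR.transpose_mul_mul hK.injective).det_pos.le]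

/-- `R` behaves like `1 1ᵀ + w I` as a quadratic form. -/
def FlatLike (a b w : ℝ) (R : Matrix ι ι ℝ) : Prop :=
  ∀ u : ι → ℝ, 1 / 2 * ((1 : ι → ℝ) ⬝ᵥ u) ^ 2 + a * w * (u ⬝ᵥ u) ≤ u ⬝ᵥ (R *ᵥ u) ∧
    u ⬝ᵥ (R *ᵥ u) ≤ ((1 : ι → ℝ) ⬝ᵥ u) ^ 2 + b * w * (u ⬝ᵥ u)

/-- Substitute Ku into the bounds on R; injectivity of K makes |Ku|² comparable with |u|². -/
theorem IsContrast.exists_flatLike_bounds {m : ℕ} {K : Matrix ι (Fin m) ℝ}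
    (hK : IsContrast X K) {a b : ℝ} (ha : 0 < a) (hb : 0 < b) :
    ∃ a' b' : ℝ, 0 < a' ∧ 0 < b' ∧ ∀ (R : Matrix ι ι ℝ) (w : ℝ), 0 < w → FlatLike a b w R →
      ∀ u, 1 / 2 * ((Kᵀ *ᵥ (1 : ι → ℝ)) ⬝ᵥ u) ^ 2 + a' * w * (u ⬝ᵥ u) ≤
          u ⬝ᵥ ((Kᵀ * R * K) *ᵥ u) ∧
        u ⬝ᵥ ((Kᵀ * R * K) *ᵥ u) ≤
          ((Kᵀ *ᵥ (1 : ι → ℝ)) ⬝ᵥ u) ^ 2 + b' * w * (u ⬝ᵥ u) := by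
  have e1 : ∀ (M : Matrix ι ι ℝ) (u : Fin m → ℝ), u ⬝ᵥ ((Kᵀ * M * K) *ᵥ u) =
      (K *ᵥ u) ⬝ᵥ (M *ᵥ (K *ᵥ u)) := by
    intro M u
    rw [← Matrix.mulVec_mulVec, ← Matrix.mulVec_mulVec, Matrix.dotProduct_mulVec,
      Matrix.vecMul_transpose]
  obtain ⟨α, hα, hKα⟩ := ((Matrix.PosDef.one (n := ι) (R := ℝ)).transpose_mul_mul
    hK.injective).exists_mul_le
  obtain ⟨β, hβ, hKβ⟩ : ∃ β : ℝ, 0 < β ∧ ∀ u, (K *ᵥ u) ⬝ᵥ (K *ᵥ u) ≤ β * (u ⬝ᵥ u) := by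
    obtain ⟨ε, hε⟩ : ∃ ε : ℝ, ∀ i j, |(Kᵀ * (1 : Matrix ι ι ℝ) * K) i j| ≤ ε := by
      obtain ⟨ε, hε⟩ := (Set.finite_range
        fun p : Fin m × Fin m => |(Kᵀ * (1 : Matrix ι ι ℝ) * K) p.1 p.2|).bddAbove
      exact ⟨ε, fun i j => hε ⟨(i, j), rfl⟩⟩
    refine ⟨max (ε * Fintype.card (Fin m)) 1, by positivity, fun u => ?_⟩
    have h1 := (le_abs_self _).trans (abs_dotProduct_mulVec_le hε u)
    rw [e1, Matrix.one_mulVec] at h1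
    exact h1.trans (mul_le_mul_of_nonneg_right (le_max_left _ _) (dotProduct_self_nonneg' u))
  refine ⟨a * α, b * β, by positivity, by positivity, fun R w hw hR u => ?_⟩
  have e2 : (Kᵀ *ᵥ (1 : ι → ℝ)) ⬝ᵥ u = (1 : ι → ℝ) ⬝ᵥ (K *ᵥ u) := by
    rw [Matrix.dotProduct_mulVec, ← Matrix.mulVec_transpose]
  have h1 := hKα u
  rw [e1, Matrix.one_mulVec] at h1
  have h2 := hKβ u
  rw [e1, e2]
  obtain ⟨h3, h4⟩ := hR (K *ᵥ u)
  have h5 := mul_le_mul_of_nonneg_left h1 (mul_pos ha hw).le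
  have h6 := mul_le_mul_of_nonneg_left h2 (mul_pos hb hw).le
  constructor
  · linarith
  · linarith

/-- The exponent m/2 is the one for a_t = 1. From |G| ≤ C₁w^(m−1) and S² ≤ C₂/w, the factor is at
least a multiple of w^(−(m−1)/2) · w^(m/2). Unlike the upper bound, this allows y ∈ C(X) + ℝ1. -/
theorem exists_le_levelFactor (hX : LinearIndependent ℝ X.col)
    (hy : y ∉ LinearMap.range X.mulVecLin) {a b : ℝ} (ha : 0 < a) (hb : 0 < b) :
    ∃ c : ℝ, 0 < c ∧ ∀ (R : Matrix ι ι ℝ) (w : ℝ), R.PosDef → 0 < w → w ≤ 1 → FlatLike a b w R →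
      c * w ^ (1 / 2 : ℝ) ≤
        levelFactor X y (((Fintype.card ι : ℝ) - Fintype.card κ) / 2) R := by
  obtain ⟨m, K, hK⟩ := exists_isContrast X hX
  obtain ⟨c₀, hc₀, hL⟩ := hK.exists_levelFactor_eq (y := y) hX
  obtain ⟨a', b', ha', hb', hG⟩ := hK.exists_flatLike_bounds ha hb
  have hz := hK.ne_zero hy
  set z := Kᵀ *ᵥ y
  set v := Kᵀ *ᵥ (1 : ι → ℝ)
  have hm : 0 < m := by
    rcases Nat.eq_zero_or_pos m with rfl | h
    · exact absurd (Subsingleton.elim z 0) hz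
    · exact h
  have : Nonempty (Fin m) := ⟨⟨0, hm⟩⟩
  have hzz := dotProduct_self_pos hz
  have hvv := dotProduct_self_nonneg' v
  have hcard : ((Fintype.card ι : ℝ) - Fintype.card κ) / 2 = (m : ℝ) / 2 := by
    rw [← hK.card_eq]
    push_cast
    ring
  set C₁ := b' ^ (m - 1) * (b' + v ⬝ᵥ v) with hC₁
  have hC₁0 : 0 < C₁ := by positivity
  set C₂ := (z ⬝ᵥ z) / a' with hC₂
  have hC₂0 : 0 < C₂ := by positivity
  refine ⟨c₀ * C₁ ^ (-(1 / 2) : ℝ) * C₂ ^ (-(m / 2) : ℝ), by positivity,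
    fun R w hR hw hw1 hF => ?_⟩
  rw [hcard, hL _ _ hR]
  have hGp := hR.transpose_mul_mul hK.injective
  have hb := hG R w hw hF
  set G := Kᵀ * R * K
  have hdet : G.det ≤ C₁ * w ^ ((m : ℝ) - 1) := by
    have hbw : 0 < b' * w := by positivity
    have h1 := hGp.det_le_det (posDef_smul_one_add_vecMulVec hbw zero_le_one v) (fun u => by
      rw [dotProduct_smul_one_add_vecMulVec]
      have := (hb u).2
      linarith)
    rw [det_smul_one_add_vecMulVec hbw.ne', Fintype.card_fin] at h1
    have h2 : w ^ ((m : ℝ) - 1) = w ^ (m - 1) := by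
      rw [← Real.rpow_natCast, Nat.cast_sub hm, Nat.cast_one]
    rw [h2, hC₁]
    calc G.det ≤ (b' * w) ^ (m - 1) * (b' * w + 1 * v ⬝ᵥ v) := h1
      _ ≤ (b' * w) ^ (m - 1) * (b' + v ⬝ᵥ v) := by
          gcongr
          · nlinarith
          · rw [one_mul]
      _ = _ := by ring
  have hS : z ⬝ᵥ (G⁻¹ *ᵥ z) ≤ C₂ * w⁻¹ := by
    have := hGp.dotProduct_inv_le (mul_pos ha' hw) (fun u => by
      have := (hb u).1
      nlinarith [sq_nonneg (v ⬝ᵥ u)]) z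
    calc _ ≤ _ := this
      _ = _ := by rw [hC₂]; field_simp
  have hS0 : 0 < z ⬝ᵥ (G⁻¹ *ᵥ z) := hGp.inv.dotProduct_pos hz
  have h1 : (C₁ * w ^ ((m : ℝ) - 1)) ^ (-(1 / 2) : ℝ) ≤ G.det ^ (-(1 / 2) : ℝ) :=
    Real.rpow_le_rpow_of_nonpos hGp.det_pos hdet (by norm_num)
  have h2 : (C₂ * w⁻¹) ^ (-((m : ℝ) / 2)) ≤ (z ⬝ᵥ (G⁻¹ *ᵥ z)) ^ (-((m : ℝ) / 2)) :=
    Real.rpow_le_rpow_of_nonpos hS0 hS (by simp; positivity)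
  calc _ = c₀ * (C₁ * w ^ ((m : ℝ) - 1)) ^ (-(1 / 2) : ℝ) * (C₂ * w⁻¹) ^ (-((m : ℝ) / 2)) := by
        rw [Real.mul_rpow hC₁0.le (by positivity), Real.mul_rpow hC₂0.le (by positivity),
          ← Real.rpow_mul hw.le, Real.inv_rpow hw.le, ← Real.rpow_neg hw.le]
        have : w ^ (1 / 2 : ℝ) = w ^ (((m : ℝ) - 1) * -(1 / 2)) * w ^ (- -((m : ℝ) / 2)) := by
          rw [← Real.rpow_add hw]
          congr 1
          ring
        rw [this]
        ring
    _ ≤ _ := by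
        have := hGp.det_pos
        gcongr

open Classical in
-- With τ = 1 if Kᵀ1 = 0 and τ = 0 otherwise, |G| ≥ C₁w^(m−1+τ), while S² is of exact order 1/w. The
-- resulting power is e − (m−1+τ)/2, and (1+τ)/2 is the constant c_t.
theorem exists_levelFactor_le (hX : LinearIndependent ℝ X.col)
    (hy : y ∉ LinearMap.range X.mulVecLin ⊔ Submodule.span ℝ {(1 : ι → ℝ)})
    {a b : ℝ} (ha : 0 < a) (hb : 0 < b) (e : ℝ) :
    ∃ C : ℝ, 0 < C ∧ ∀ (R : Matrix ι ι ℝ) (w : ℝ), R.PosDef → 0 < w → FlatLike a b w R →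
      levelFactor X y e R ≤ C * w ^ (e - ((Fintype.card ι : ℝ) - Fintype.card κ) / 2 + 1 -
        if (1 : ι → ℝ) ∈ LinearMap.range X.mulVecLin then 1 else 1 / 2) := by
  obtain ⟨m, K, hK⟩ := exists_isContrast X hX
  obtain ⟨c₀, hc₀, hL⟩ := hK.exists_levelFactor_eq (y := y) hX
  obtain ⟨a', b', ha', hb', hG⟩ := hK.exists_flatLike_bounds ha hb
  have hz := hK.ne_zero (fun h => hy (Submodule.mem_sup_left h))
  have hcard : ((Fintype.card ι : ℝ) - Fintype.card κ) / 2 = (m : ℝ) / 2 := by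
    rw [← hK.card_eq]
    push_cast
    ring
  have hone : (1 : ι → ℝ) ∈ LinearMap.range X.mulVecLin ↔ Kᵀ *ᵥ (1 : ι → ℝ) = 0 := by
    constructor
    · rintro ⟨x, hx⟩
      rw [← hx, Matrix.mulVecLin_apply, Matrix.mulVec_mulVec, hK.transpose_mul, Matrix.zero_mulVec]
    · exact hK.mem_range _
  have hspan : ∀ t : ℝ, Kᵀ *ᵥ y - t • (Kᵀ *ᵥ (1 : ι → ℝ)) ≠ 0 := by
    intro t h
    rw [← Matrix.mulVec_smul, ← Matrix.mulVec_sub] at h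
    obtain ⟨x, hx⟩ := hK.mem_range _ h
    apply hy
    have : y = X *ᵥ x + t • (1 : ι → ℝ) := by rw [hx]; abel
    rw [this]
    exact Submodule.add_mem_sup ⟨x, rfl⟩ (Submodule.smul_mem _ _ (Submodule.mem_span_singleton_self _))
  rw [hcard]
  simp only [hone]
  set z := Kᵀ *ᵥ y
  set v := Kᵀ *ᵥ (1 : ι → ℝ)
  have hm : 0 < m := by
    rcases Nat.eq_zero_or_pos m with rfl | h
    · exact absurd (Subsingleton.elim z 0) hz
    · exact h
  have : Nonempty (Fin m) := ⟨⟨0, hm⟩⟩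
  have hzz := dotProduct_self_pos hz
  -- u₀ is the component of z orthogonal to v, nonzero because y ∉ C(X) + ℝ1. For v = 0 the quotient
  -- is 0 by convention and u₀ = z, as wanted.
  set t := (v ⬝ᵥ z) / (v ⬝ᵥ v) with ht
  set u₀ := z - t • v with hu₀
  have hu0 := dotProduct_self_pos (hspan t)
  rw [← hu₀] at hu0
  have hvu : v ⬝ᵥ u₀ = 0 := by
    rw [hu₀, dotProduct_sub, dotProduct_smul, smul_eq_mul, ht]
    by_cases hv : v = 0
    · simp [hv]
    · have := (dotProduct_self_pos hv).ne'
      field_simp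
      ring
  have huz : u₀ ⬝ᵥ z = u₀ ⬝ᵥ u₀ := by
    have : z = u₀ + t • v := by rw [hu₀]; abel
    conv_lhs => rw [this]
    rw [dotProduct_add, dotProduct_smul, dotProduct_comm u₀ v, hvu, smul_zero, add_zero]
  set τ : ℝ := if v = 0 then 1 else 0 with hτ
  obtain ⟨C₁, hC₁0, hC₁⟩ : ∃ C₁ : ℝ, 0 < C₁ ∧ ∀ w : ℝ, 0 < w →
      C₁ * w ^ ((m : ℝ) - 1 + τ) ≤ (a' * w) ^ (m - 1) * (a' * w + 1 / 2 * v ⬝ᵥ v) := by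
    by_cases hv : v = 0
    · refine ⟨a' ^ m, by positivity, fun w hw => le_of_eq ?_⟩
      have : m - 1 + 1 = m := Nat.sub_add_cancel hm
      simp only [hτ, hv, if_true, sub_add_cancel, Real.rpow_natCast, dotProduct_zero, mul_zero,
        add_zero]
      rw [← pow_succ, this, mul_pow]
    · have hvv := dotProduct_self_pos hv
      refine ⟨a' ^ (m - 1) * (1 / 2 * v ⬝ᵥ v), by positivity, fun w hw => ?_⟩
      have h2 : w ^ ((m : ℝ) - 1 + τ) = w ^ (m - 1) := by
        rw [← Real.rpow_natCast, Nat.cast_sub hm, Nat.cast_one, hτ, if_neg hv, add_zero]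
      rw [h2]
      calc _ = (a' * w) ^ (m - 1) * (1 / 2 * v ⬝ᵥ v) := by ring
        _ ≤ _ := by
          gcongr
          have : 0 < a' * w := by positivity
          linarith
  set C₂ := (z ⬝ᵥ z) / a' with hC₂
  have hC₂0 : 0 < C₂ := by positivity
  set C₃ := (u₀ ⬝ᵥ u₀) / b' with hC₃
  have hC₃0 : 0 < C₃ := by positivity
  refine ⟨c₀ * C₁ ^ (-(1 / 2) : ℝ) * (C₂ ^ (-e) + C₃ ^ (-e)), by positivity,
    fun R w hR hw hF => ?_⟩
  rw [hL _ _ hR]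
  have hGp := hR.transpose_mul_mul hK.injective
  have hb := hG R w hw hF
  set G := Kᵀ * R * K
  have haw : 0 < a' * w := by positivity
  have hdet : C₁ * w ^ ((m : ℝ) - 1 + τ) ≤ G.det := by
    have h1 := (posDef_smul_one_add_vecMulVec haw (by norm_num : (0 : ℝ) ≤ 1 / 2) v).det_le_det
      hGp (fun u => by
        rw [dotProduct_smul_one_add_vecMulVec]
        have := (hb u).1
        linarith)
    rw [det_smul_one_add_vecMulVec haw.ne', Fintype.card_fin] at h1
    exact (hC₁ w hw).trans h1
  have hS : z ⬝ᵥ (G⁻¹ *ᵥ z) ≤ C₂ * w⁻¹ := by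
    have := hGp.dotProduct_inv_le haw (fun u => by
      have := (hb u).1
      nlinarith [sq_nonneg (v ⬝ᵥ u)]) z
    calc _ ≤ _ := this
      _ = _ := by rw [hC₂]; field_simp
  have hS0 : 0 < z ⬝ᵥ (G⁻¹ *ᵥ z) := hGp.inv.dotProduct_pos hz
  -- Cauchy–Schwarz tested on u₀, where the rank-one part of the upper bound for G vanishes.
  have hS' : C₃ * w⁻¹ ≤ z ⬝ᵥ (G⁻¹ *ᵥ z) := by
    have h1 := hGp.sq_dotProduct_le u₀ z
    have h2 := (hb u₀).2
    rw [hvu] at h2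
    rw [huz] at h1
    have h3 : (u₀ ⬝ᵥ u₀) ^ 2 ≤ b' * w * (u₀ ⬝ᵥ u₀) * (z ⬝ᵥ (G⁻¹ *ᵥ z)) :=
      h1.trans (mul_le_mul_of_nonneg_right (by linarith) hS0.le)
    have h4 : u₀ ⬝ᵥ u₀ ≤ b' * w * (z ⬝ᵥ (G⁻¹ *ᵥ z)) := by
      apply le_of_mul_le_mul_left _ hu0
      linarith
    rw [hC₃, ← div_eq_mul_inv, div_div, div_le_iff₀ (by positivity)]
    linarith
  have h1 : G.det ^ (-(1 / 2) : ℝ) ≤ (C₁ * w ^ ((m : ℝ) - 1 + τ)) ^ (-(1 / 2) : ℝ) :=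
    Real.rpow_le_rpow_of_nonpos (by positivity) hdet (by norm_num)
  -- The sign of e decides which of the two bounds on S² applies; the sum of the constants covers
  -- both cases.
  have h2 : (z ⬝ᵥ (G⁻¹ *ᵥ z)) ^ (-e) ≤ (C₂ ^ (-e) + C₃ ^ (-e)) * w ^ e := by
    have e1 : ∀ C : ℝ, 0 < C → (C * w⁻¹) ^ (-e) = C ^ (-e) * w ^ e := by
      intro C hC
      rw [Real.mul_rpow hC.le (by positivity), Real.inv_rpow hw.le, ← Real.rpow_neg hw.le, neg_neg]
    rw [add_mul, ← e1 _ hC₂0, ← e1 _ hC₃0]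
    have p2 : 0 < (C₂ * w⁻¹) ^ (-e) := by positivity
    have p3 : 0 < (C₃ * w⁻¹) ^ (-e) := by positivity
    rcases le_total 0 e with he | he
    · have := Real.rpow_le_rpow_of_nonpos (by positivity) hS' (neg_nonpos.2 he)
      linarith
    · have := Real.rpow_le_rpow hS0.le hS (neg_nonneg.2 he)
      linarith
  calc _ ≤ c₀ * (C₁ * w ^ ((m : ℝ) - 1 + τ)) ^ (-(1 / 2) : ℝ) *
        ((C₂ ^ (-e) + C₃ ^ (-e)) * w ^ e) := by gcongr
    _ = _ := by
        rw [Real.mul_rpow hC₁0.le (by positivity), ← Real.rpow_mul hw.le]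
        have : w ^ (e - (m : ℝ) / 2 + 1 - if v = 0 then 1 else 1 / 2) =
            w ^ (((m : ℝ) - 1 + τ) * -(1 / 2)) * w ^ e := by
          rw [← Real.rpow_add hw]
          congr 1
          rw [hτ]
          split_ifs <;> ring
        rw [this]
        ring

end LevelFactor

/-! ### One-dimensional correlation functions and their large-range expansion. -/

section Correlation

namespace IsCorrelationFunction

variable {r : ℝ → ℝ} (hr : IsCorrelationFunction r)
include hr

theorem abs_lt_one {u : ℝ} (hu : 0 < u) : |r u| < 1 := by
  have h := (hr.posDef 2 ![0, u] (by
    intro i j hij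
    fin_cases i <;> fin_cases j <;> simp_all [hu.ne, hu.ne'])).det_pos
  rw [Matrix.det_fin_two] at h
  simp only [Matrix.of_apply, Matrix.cons_val_zero, Matrix.cons_val_one, sub_self, abs_zero,
    hr.map_zero, zero_sub, abs_neg, sub_zero, abs_of_pos hu] at h
  rw [abs_lt]
  constructor <;> nlinarith

theorem abs_le_one {u : ℝ} (hu : 0 ≤ u) : |r u| ≤ 1 := by
  rcases hu.eq_or_lt with rfl | h
  · simp [hr.map_zero]
  · exact (hr.abs_lt_one h).le

/-- Test positive definiteness at the points 0, u, 2u on the second difference (1, −2, 1). -/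
theorem one_sub_two_mul_le {u : ℝ} (hu : 0 < u) : 1 - r (2 * u) ≤ 4 * (1 - r u) := by
  have h := (hr.posDef 3 ![0, u, 2 * u] (by
    intro i j hij
    fin_cases i <;> fin_cases j <;> simp_all [hu.ne, hu.ne'])).dotProduct_pos
    (u := ![1, -2, 1]) (by
      intro h0
      simpa using congrFun h0 0)
  have e1 : |u - 2 * u| = u := by rw [abs_of_neg] <;> linarith
  have e2 : |2 * u - u| = u := by rw [abs_of_pos] <;> linarith
  have e3 : |2 * u| = 2 * u := abs_of_pos (by linarith)
  simp [Matrix.mulVec, dotProduct, Fin.sum_univ_three, hr.map_zero, abs_of_pos hu, e1, e2] at h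
  linarith

theorem one_sub_two_pow_mul_le {u : ℝ} (hu : 0 < u) (k : ℕ) :
    1 - r (2 ^ k * u) ≤ 4 ^ k * (1 - r u) := by
  induction k with
  | zero => simp
  | succ k ih =>
    have h := hr.one_sub_two_mul_le (u := 2 ^ k * u) (by positivity)
    have e : (2 : ℝ) ^ (k + 1) * u = 2 * (2 ^ k * u) := by ring
    rw [e]
    calc _ ≤ 4 * (1 - r (2 ^ k * u)) := h
      _ ≤ 4 * (4 ^ k * (1 - r u)) := by linarith
      _ = _ := by ring

/-- A correlation function is at most quadratically close to `1` at the origin. -/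
theorem exists_sq_le (hc : ∀ u : ℝ, 0 < u → ContinuousOn (fun φ => r (u / φ)) (Set.Ioi 0)) :
    ∃ c : ℝ, 0 < c ∧ ∀ s : ℝ, 0 < s → s ≤ 1 → c * s ^ 2 ≤ 1 - r s := by
  -- Continuity is given in the range parameter, so r on [1/2, 1] is written as r(1/φ) with φ ∈ [1,
  -- 2].
  have hcont : ContinuousOn (fun φ : ℝ => 1 - r (1 / φ)) (Set.Icc 1 2) :=
    continuousOn_const.sub ((hc 1 one_pos).mono fun φ hφ => lt_of_lt_of_le one_pos hφ.1)
  obtain ⟨φ₁, hφ₁, hmin⟩ := isCompact_Icc.exists_isMinOn (Set.nonempty_Icc.2 one_le_two) hcont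
  have hφ₁0 : (0 : ℝ) < φ₁ := lt_of_lt_of_le one_pos hφ₁.1
  have hpos : 0 < 1 - r (1 / φ₁) := by
    have := (abs_lt.1 (hr.abs_lt_one (one_div_pos.2 hφ₁0))).2
    linarith
  refine ⟨1 - r (1 / φ₁), hpos, fun s hs hs1 => ?_⟩
  -- Doubling brings s into (1/2, 1], where the minimum applies; the cost 4^k is at most 1/s².
  obtain ⟨k, hk1, hk2⟩ := exists_nat_pow_near (one_le_one_div hs hs1) one_lt_two
  have hk0 : (0 : ℝ) < 2 ^ k := by positivity
  have hks : 2 ^ k * s ≤ 1 := by rwa [le_div_iff₀ hs] at hk1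
  have hks2 : 1 < 2 ^ (k + 1) * s := by rwa [div_lt_iff₀ hs] at hk2
  have hφ : 1 / (2 ^ k * s) ∈ Set.Icc (1 : ℝ) 2 := by
    constructor
    · exact one_le_one_div (by positivity) hks
    · rw [div_le_iff₀ (by positivity)]
      rw [pow_succ] at hks2
      linarith
  have h1 := hmin hφ
  simp only [Set.mem_ofPred_eq, one_div_one_div] at h1
  have h2 := hr.one_sub_two_pow_mul_le hs k
  have h3 : s ^ 2 * 4 ^ k ≤ 1 := by
    have : s ^ 2 * 4 ^ k = (2 ^ k * s) ^ 2 := by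
      rw [mul_pow, ← pow_mul, mul_comm k 2, pow_mul]
      norm_num
      ring
    rw [this]
    exact pow_le_one₀ (by positivity) hks
  have h4 : (1 - r (1 / φ₁)) * s ^ 2 ≤ 4 ^ k * (1 - r s) * s ^ 2 :=
    mul_le_mul_of_nonneg_right (h1.trans h2) (sq_nonneg s)
  have h5 : 0 ≤ 1 - r s := by
    have := (abs_lt.1 (hr.abs_lt_one hs)).2
    linarith
  nlinarith

theorem corrMatrix_posDef {ι : Type} [Fintype ι] {x : ι → ℝ} (hx : Function.Injective x) {φ : ℝ}
    (hφ : 0 < φ) : (corrMatrix r x φ).PosDef := by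
  classical
  let e := Fintype.equivFin ι
  have h := (hr.posDef _ (fun i => x (e.symm i) / φ) (by
    intro i j hij
    exact e.symm.injective (hx ((div_left_inj' hφ.ne').1 hij)))).submatrix e.injective
  convert h using 1
  ext i j
  simp [corrMatrix, ← sub_div, abs_div, abs_of_pos hφ]

end IsCorrelationFunction

theorem corrMatrix_symm {ι : Type} (r : ℝ → ℝ) (x : ι → ℝ) (φ : ℝ) (i j : ι) :
    corrMatrix r x φ i j = corrMatrix r x φ j i := by
  simp [corrMatrix, abs_sub_comm]

variable {ι : Type} [Fintype ι] [DecidableEq ι]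

namespace CorrelationAssumption

variable {r : ℝ → ℝ} {x : ι → ℝ} {ν ω : ℝ → ℝ} {D Dstar : Matrix ι ι ℝ} {B : ℝ → Matrix ι ι ℝ}
  (hA : CorrelationAssumption r x ν ω D Dstar B)
include hA

/-- The entrywise limit is all that is drawn from the expansion; symmetry, signs and growth below
are deduced from it. -/
theorem tendsto_entry (i j : ι) :
    Tendsto (fun φ => (corrMatrix r x φ i j - 1) / ν φ) atTop (𝓝 (D i j)) := by
  have hB : Tendsto (fun φ => B φ i j) atTop (𝓝 0) := by
    refine squeeze_zero_norm (fun φ => ?_) hA.B_tendsto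
    exact (norm_le_pi_norm (fun j => B φ i j) j).trans
      (norm_le_pi_norm (fun i j => B φ i j : ι → ι → ℝ) i)
  have h : Tendsto (fun φ => D i j + ω φ * (Dstar i j + B φ i j)) atTop
      (𝓝 (D i j + 0 * (Dstar i j + 0))) :=
    tendsto_const_nhds.add (hA.ω_tendsto.mul (tendsto_const_nhds.add hB))
  rw [zero_mul, add_zero] at h
  refine h.congr' ?_
  filter_upwards [hA.expansion, eventually_gt_atTop 0] with φ hφ h0
  have hν := (hA.ν_pos φ h0).ne'
  rw [hφ]
  simp only [Matrix.add_apply, Matrix.of_apply, Matrix.smul_apply, smul_eq_mul]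
  field_simp
  ring

theorem D_symm (i j : ι) : D i j = D j i := by
  refine tendsto_nhds_unique (hA.tendsto_entry i j) ?_
  simpa only [corrMatrix_symm r x _ i j] using hA.tendsto_entry j i

/-- Two points with the same coordinate would give D two equal rows. -/
theorem injective : Function.Injective x := by
  intro i j hij
  by_contra hne
  have h : D i = D j := by
    funext k
    refine tendsto_nhds_unique (hA.tendsto_entry i k) ?_
    refine (hA.tendsto_entry j k).congr fun φ => ?_
    simp [corrMatrix, hij]
  exact hA.D_nonsingular.ne_zero (Matrix.det_zero_of_row_eq hne h)

theorem tendsto_quadratic (u : ι → ℝ) (hu : (1 : ι → ℝ) ⬝ᵥ u = 0) :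
    Tendsto (fun φ => (u ⬝ᵥ (corrMatrix r x φ *ᵥ u)) / ν φ) atTop (𝓝 (u ⬝ᵥ (D *ᵥ u))) := by
  have h : Tendsto (fun φ => ∑ i, u i * ∑ j, (corrMatrix r x φ i j - 1) / ν φ * u j) atTop
      (𝓝 (∑ i, u i * ∑ j, D i j * u j)) :=
    tendsto_finsetSum _ fun i _ => (tendsto_finsetSum _ fun j _ =>
      (hA.tendsto_entry i j).mul_const _).const_mul _
  refine h.congr fun φ => ?_
  have hs : ∑ j, u j = 0 := by simpa [dotProduct] using hu
  simp only [Matrix.mulVec, dotProduct, Finset.sum_div]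
  refine Finset.sum_congr rfl fun i _ => ?_
  have : ∑ j, (corrMatrix r x φ i j - 1) / ν φ * u j =
      (∑ j, corrMatrix r x φ i j * u j) / ν φ := by
    rw [Finset.sum_div]
    have : ∀ j, (corrMatrix r x φ i j - 1) / ν φ * u j =
        corrMatrix r x φ i j * u j / ν φ - (ν φ)⁻¹ * u j := fun j => by ring
    simp only [this, Finset.sum_sub_distrib, ← Finset.mul_sum, hs, mul_zero, sub_zero]
  rw [this]
  ring

theorem D_nonneg (hr : IsCorrelationFunction r) (u : ι → ℝ) (hu : (1 : ι → ℝ) ⬝ᵥ u = 0) :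
    0 ≤ u ⬝ᵥ (D *ᵥ u) := by
  refine ge_of_tendsto (hA.tendsto_quadratic u hu) ?_
  filter_upwards [eventually_gt_atTop 0] with φ hφ
  refine div_nonneg ?_ (hA.ν_pos φ hφ).le
  simpa using (hr.corrMatrix_posDef hA.injective hφ).posSemidef.dotProduct_mulVec_nonneg u

/-- The leading matrix of the expansion is positive definite on the vectors with sum zero. -/
theorem D_pos (hr : IsCorrelationFunction r) (z : ι → ℝ) (hz : z ≠ 0)
    (h1 : (1 : ι → ℝ) ⬝ᵥ z = 0) : 0 < z ⬝ᵥ (D *ᵥ z) := by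
  refine lt_of_le_of_ne (hA.D_nonneg hr z h1) fun h0 => ?_
  have hsymm : ∀ u w : ι → ℝ, u ⬝ᵥ (D *ᵥ w) = w ⬝ᵥ (D *ᵥ u) := by
    intro u w
    have : Dᵀ = D := by
      ext i j
      exact hA.D_symm j i
    rw [Matrix.dotProduct_mulVec, ← Matrix.mulVec_transpose, this, dotProduct_comm]
  -- z is a zero of a form that is nonnegative on 1^⊥, hence a minimiser, so Dz is orthogonal to
  -- 1^⊥. The coefficient −b/(q+1) would give a negative value if b ≠ 0, and its denominator is
  -- positive even when q = 0.
  have horth : ∀ w : ι → ℝ, (1 : ι → ℝ) ⬝ᵥ w = 0 → w ⬝ᵥ (D *ᵥ z) = 0 := by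
    intro w hw
    by_contra hb
    have hq := hA.D_nonneg hr w hw
    set q := w ⬝ᵥ (D *ᵥ w)
    set b := w ⬝ᵥ (D *ᵥ z) with hbdef
    have h2 := hA.D_nonneg hr (z + (-b / (q + 1)) • w) (by
      rw [dotProduct_add, dotProduct_smul, h1, hw]
      simp)
    have h3 : (z + (-b / (q + 1)) • w) ⬝ᵥ (D *ᵥ (z + (-b / (q + 1)) • w)) =
        -(b ^ 2 * (q + 2)) / (q + 1) ^ 2 := by
      rw [Matrix.mulVec_add, Matrix.mulVec_smul, add_dotProduct, dotProduct_add, dotProduct_add,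
        ← h0, smul_dotProduct, smul_dotProduct, dotProduct_smul, dotProduct_smul, hsymm z w]
      simp only [smul_eq_mul]
      rw [← hbdef]
      field_simp
      ring
    rw [h3] at h2
    have : 0 < b ^ 2 * (q + 2) / (q + 1) ^ 2 := by positivity
    rw [neg_div] at h2
    linarith
  have hne : Nonempty ι := by
    by_contra h
    rw [not_nonempty_iff] at h
    exact hz (Subsingleton.elim _ _)
  have hcard : (Fintype.card ι : ℝ) ≠ 0 := by simp
  set μ := ((1 : ι → ℝ) ⬝ᵥ (D *ᵥ z)) / Fintype.card ι with hμ
  have hw : (1 : ι → ℝ) ⬝ᵥ (D *ᵥ z - μ • (1 : ι → ℝ)) = 0 := by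
    rw [dotProduct_sub, dotProduct_smul, dotProduct_one (1 : ι → ℝ), hμ]
    simp
  have h2 := horth _ hw
  have h3 : D *ᵥ z - μ • (1 : ι → ℝ) = 0 := by
    rw [← dotProduct_self_eq_zero, dotProduct_sub, dotProduct_smul,
      dotProduct_comm _ (1 : ι → ℝ), hw, h2]
    simp
  -- Now Dz = μ1; since z has sum zero and 1ᵀD⁻¹1 ≠ 0, this forces μ = 0.
  have h4 : z = μ • (D⁻¹ *ᵥ (1 : ι → ℝ)) := by
    rw [← Matrix.mulVec_smul, ← sub_eq_zero.1 h3, Matrix.mulVec_mulVec,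
      Matrix.nonsing_inv_mul _ hA.D_nonsingular, Matrix.one_mulVec]
  have h5 : μ = 0 := by
    rw [h4, dotProduct_smul, smul_eq_mul] at h1
    exact (mul_eq_zero.1 h1).resolve_right hA.D_one
  rw [h5, zero_smul] at h4
  exact hz h4

/-- With a single point the correlation matrix is constantly 1, so D would be the zero matrix. -/
theorem exists_ne [Nonempty ι] (hr : r 0 = 1) : ∃ i j : ι, i ≠ j := by
  by_contra! h
  have hD : D = 0 := by
    ext i j
    refine tendsto_nhds_unique (hA.tendsto_entry i j) ?_
    simp [h i j, corrMatrix, hr]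
  have := hA.D_nonsingular
  rw [hD, Matrix.det_zero] at this
  exact not_isUnit_zero this

/-- For two distinct points, 1 − r(u/φ) is at least c(u/φ)² and eventually at most (|D i j| +
1)ν(φ). -/
theorem exists_div_sq_le [Nonempty ι] (hr : IsCorrelationFunction r) :
    ∃ c : ℝ, 0 < c ∧ ∀ᶠ φ in atTop, c / φ ^ 2 ≤ ν φ := by
  obtain ⟨i, j, hij⟩ := hA.exists_ne hr.map_zero
  obtain ⟨c, hc, hcr⟩ := hr.exists_sq_le hA.continuousOn
  have hu : 0 < |x i - x j| := abs_pos.2 (sub_ne_zero.2 fun h => hij (hA.injective h))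
  set u := |x i - x j|
  refine ⟨c * u ^ 2 / (|D i j| + 1), by positivity, ?_⟩
  have h1 := (hA.tendsto_entry i j).abs.eventually (gt_mem_nhds (lt_add_one |D i j|))
  filter_upwards [h1, eventually_ge_atTop u, eventually_gt_atTop 0] with φ h2 h3 h4
  have h5 := hcr (u / φ) (by positivity) ((div_le_one h4).2 h3)
  have hν := hA.ν_pos φ h4
  rw [abs_div, abs_of_pos hν, div_lt_iff₀ hν] at h2
  have h6 : 1 - r (u / φ) ≤ |corrMatrix r x φ i j - 1| := by
    rw [abs_sub_comm]
    exact le_abs_self _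
  rw [div_div, div_le_iff₀ (by positivity)]
  rw [div_pow, ← mul_div_assoc, div_le_iff₀ (by positivity)] at h5
  calc _ ≤ (1 - r (u / φ)) * φ ^ 2 := h5
    _ ≤ ((|D i j| + 1) * ν φ) * φ ^ 2 := by
        gcongr
        linarith
    _ = _ := by ring

end CorrelationAssumption

end Correlation

/-! ### Product correlations in several input dimensions. -/

section ProductCorrelation

/-- The entrywise product over the input dimensions of the correlation matrices. -/
noncomputable def prodCorr {ι : Type} {d : ℕ} (r : Fin d → ℝ → ℝ) (x : ι → Fin d → ℝ) (φ : Fin d → ℝ) :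
    Matrix ι ι ℝ :=
  Matrix.of fun i j => ∏ ℓ, corrMatrix (r ℓ) (fun i => x i ℓ) (φ ℓ) i j

/-- Schur product theorem. The index set must be nonempty, since the empty product is the all-ones
matrix. -/
theorem posDef_entrywise_prod {ι κ : Type} {A : κ → Matrix ι ι ℝ}
    (hA : ∀ k, (A k).PosDef) {s : Finset κ} (hs : s.Nonempty) :
    (Matrix.of fun i j => ∏ k ∈ s, A k i j).PosDef := by
  induction hs using Finset.Nonempty.cons_induction with
  | singleton a =>
    have : (Matrix.of fun i j => ∏ k ∈ ({a} : Finset κ), A k i j) = A a := by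
      ext i j
      simp
    rw [this]
    exact hA a
  | cons a s has _ ih =>
    have : (Matrix.of fun i j => ∏ k ∈ Finset.cons a s has, A k i j) =
        (A a).hadamard (Matrix.of fun i j => ∏ k ∈ s, A k i j) := by
      ext i j
      simp
    rw [this]
    exact (hA a).hadamard ih

/-- First-order expansion of a product of factors close to `1`. -/
theorem isLittleO_prod_one_add {α κ : Type} {l : Filter α} {e n : κ → α → ℝ}
    {w : α → ℝ} (hw : Tendsto w l (𝓝 0)) (hn : ∀ k, n k =O[l] w)
    (h : ∀ k, (fun a => e k a - n k a) =o[l] w) (s : Finset κ) :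
    (fun a => ∏ k ∈ s, (1 + e k a) - 1 - ∑ k ∈ s, n k a) =o[l] w := by
  classical
  have he : ∀ k, e k =O[l] w := fun k => by
    simpa using (h k).isBigO.add (hn k)
  induction s using Finset.induction_on with
  | empty => simp
  | insert a s has ih =>
    have hP : (fun x => ∏ k ∈ s, (1 + e k x) - 1) =o[l] fun _ => (1 : ℝ) := by
      rw [isLittleO_one_iff]
      have : Tendsto (fun x => ∏ k ∈ s, (1 + e k x)) l (𝓝 (∏ _k ∈ s, (1 + 0))) :=
        tendsto_finsetProd _ fun k _ => tendsto_const_nhds.add ((he k).trans_tendsto hw)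
      simpa using this.sub_const 1
    -- The only new cross term is e_a times (partial product − 1), which is O(w)·o(1).
    have h1 := (he a).mul_isLittleO hP
    simp only [mul_one] at h1
    refine ((ih.add h1).add (h a)).congr_left fun x => ?_
    rw [Finset.prod_insert has, Finset.sum_insert has]
    ring

variable {ι : Type} {d : ℕ} {r : Fin d → ℝ → ℝ} {x : ι → Fin d → ℝ}

theorem prodCorr_posDef [Fintype ι] (hd : 0 < d) (hr : ∀ ℓ, IsCorrelationFunction (r ℓ))
    (hx : ∀ ℓ, Function.Injective fun i => x i ℓ) {φ : Fin d → ℝ} (hφ : ∀ ℓ, 0 < φ ℓ) :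
    (prodCorr r x φ).PosDef :=
  posDef_entrywise_prod (fun ℓ => (hr ℓ).corrMatrix_posDef (hx ℓ) (hφ ℓ))
    ⟨⟨0, hd⟩, Finset.mem_univ _⟩

theorem corrMatrix_abs_le_one {r : ℝ → ℝ} (hr : IsCorrelationFunction r) (x : ι → ℝ) {φ : ℝ}
    (hφ : 0 < φ) (i j : ι) : |corrMatrix r x φ i j| ≤ 1 :=
  hr.abs_le_one (by positivity)

theorem continuousAt_corrMatrix {r : ℝ → ℝ}
    (hc : ∀ u : ℝ, 0 < u → ContinuousOn (fun φ => r (u / φ)) (Set.Ioi 0)) (x : ι → ℝ) {φ : ℝ}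
    (hφ : 0 < φ) (i j : ι) : ContinuousAt (fun φ => corrMatrix r x φ i j) φ := by
  simp only [corrMatrix, Matrix.of_apply]
  rcases (abs_nonneg (x i - x j)).eq_or_lt with h | h
  · simp only [← h, zero_div]
    exact continuousAt_const
  · exact (hc _ h).continuousAt (Ioi_mem_nhds hφ)

theorem tendsto_corrMatrix_zero {r : ℝ → ℝ} (hr : Tendsto r atTop (𝓝 0)) {x : ι → ℝ}
    (hx : Function.Injective x) {i j : ι} (hij : i ≠ j) :
    Tendsto (fun φ => corrMatrix r x φ i j) (𝓝[>] 0) (𝓝 0) := by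
  have hu : 0 < |x i - x j| := abs_pos.2 (sub_ne_zero.2 fun h => hij (hx h))
  simp only [corrMatrix, Matrix.of_apply, div_eq_mul_inv]
  exact hr.comp (tendsto_inv_nhdsGT_zero.const_mul_atTop hu)

/-- If some range tends to 0, its factor kills every off-diagonal entry uniformly in the other
ranges, whose factors are bounded by 1; the limit is the identity. Otherwise the entries are
continuous at φ₀. -/
theorem exists_tendsto_prodCorr [Fintype ι] [DecidableEq ι] (hd : 0 < d)
    (hr : ∀ ℓ, IsCorrelationFunction (r ℓ))
    (hx : ∀ ℓ, Function.Injective fun i => x i ℓ)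
    (hc : ∀ ℓ, ∀ u : ℝ, 0 < u → ContinuousOn (fun φ => r ℓ (u / φ)) (Set.Ioi 0))
    (h0 : ∀ ℓ, Tendsto (r ℓ) atTop (𝓝 0)) {φ₀ : Fin d → ℝ} (hφ₀ : ∀ ℓ, 0 ≤ φ₀ ℓ) :
    ∃ R₀ : Matrix ι ι ℝ, R₀.PosDef ∧
      Tendsto (prodCorr r x) (𝓝[{φ | ∀ ℓ, 0 < φ ℓ}] φ₀) (𝓝 R₀) := by
  by_cases hz : ∃ ℓ, φ₀ ℓ = 0
  · obtain ⟨ℓ, hℓ⟩ := hz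
    refine ⟨1, Matrix.PosDef.one, ?_⟩
    refine tendsto_pi_nhds.2 fun i => tendsto_pi_nhds.2 fun j => ?_
    by_cases hij : i = j
    · subst hij
      refine tendsto_const_nhds.congr fun φ => ?_
      simp [prodCorr, corrMatrix, (hr _).map_zero]
    · rw [Matrix.one_apply_ne hij]
      have h1 : Tendsto (fun φ : Fin d → ℝ => φ ℓ) (𝓝[{φ | ∀ ℓ, 0 < φ ℓ}] φ₀) (𝓝[>] 0) := by
        refine tendsto_nhdsWithin_iff.2 ⟨?_, ?_⟩
        · rw [← hℓ]
          exact ((continuous_apply ℓ).tendsto φ₀).mono_left nhdsWithin_le_nhds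
        · filter_upwards [self_mem_nhdsWithin] with φ hφ using hφ ℓ
      have h2 := ((tendsto_corrMatrix_zero (h0 ℓ) (hx ℓ) hij).comp h1).abs
      rw [abs_zero] at h2
      refine squeeze_zero_norm' ?_ h2
      filter_upwards [self_mem_nhdsWithin] with φ hφ
      rw [prodCorr, Matrix.of_apply, Real.norm_eq_abs, Finset.abs_prod,
        ← Finset.mul_prod_erase _ _ (Finset.mem_univ ℓ)]
      exact mul_le_of_le_one_right (abs_nonneg _) (Finset.prod_le_one (fun _ _ => abs_nonneg _)
        fun k _ => corrMatrix_abs_le_one (hr k) _ (hφ k) i j)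
  · push Not at hz
    have hpos : ∀ ℓ, 0 < φ₀ ℓ := fun ℓ => lt_of_le_of_ne (hφ₀ ℓ) (hz ℓ).symm
    refine ⟨prodCorr r x φ₀, prodCorr_posDef hd hr hx hpos, ?_⟩
    refine Tendsto.mono_left ?_ nhdsWithin_le_nhds
    refine tendsto_pi_nhds.2 fun i => tendsto_pi_nhds.2 fun j => ?_
    have h1 : ∀ ℓ ∈ Finset.univ, Tendsto
        (fun φ : Fin d → ℝ => corrMatrix (r ℓ) (fun i => x i ℓ) (φ ℓ) i j) (𝓝 φ₀)
        (𝓝 (corrMatrix (r ℓ) (fun i => x i ℓ) (φ₀ ℓ) i j)) := fun ℓ _ =>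
      (continuousAt_corrMatrix (hc ℓ) (fun i => x i ℓ) (hpos ℓ) i j).tendsto.comp
        ((continuous_apply ℓ).tendsto φ₀)
    exact tendsto_finsetProd _ h1

variable [Fintype ι] [DecidableEq ι] {ν ω : Fin d → ℝ → ℝ} {D Dstar : Fin d → Matrix ι ι ℝ}
  {B : Fin d → ℝ → Matrix ι ι ℝ}

theorem eventually_pi_pos (d : ℕ) :
    ∀ᶠ φ in Filter.pi fun _ : Fin d => (atTop : Filter ℝ), ∀ ℓ, 0 < φ ℓ :=
  eventually_all.2 fun ℓ => (tendsto_eval_pi _ ℓ).eventually (eventually_gt_atTop 0)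

theorem tendsto_sum_ν
    (hA : ∀ ℓ, CorrelationAssumption (r ℓ) (fun i => x i ℓ) (ν ℓ) (ω ℓ) (D ℓ) (Dstar ℓ) (B ℓ)) :
    Tendsto (fun φ : Fin d → ℝ => ∑ ℓ, ν ℓ (φ ℓ)) (Filter.pi fun _ => atTop) (𝓝 0) := by
  rw [← Finset.sum_const_zero (s := (Finset.univ : Finset (Fin d)))]
  exact tendsto_finsetSum _ fun ℓ _ => (hA ℓ).ν_tendsto.comp (tendsto_eval_pi _ ℓ)

theorem isLittleO_prodCorr
    (hA : ∀ ℓ, CorrelationAssumption (r ℓ) (fun i => x i ℓ) (ν ℓ) (ω ℓ) (D ℓ) (Dstar ℓ) (B ℓ))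
    (i j : ι) :
    (fun φ : Fin d → ℝ => prodCorr r x φ i j - 1 - ∑ ℓ, ν ℓ (φ ℓ) * D ℓ i j)
      =o[Filter.pi fun _ => atTop] fun φ => ∑ ℓ, ν ℓ (φ ℓ) := by
  have hν : ∀ ℓ, (fun φ : Fin d → ℝ => ν ℓ (φ ℓ)) =O[Filter.pi fun _ => atTop]
      fun φ => ∑ ℓ, ν ℓ (φ ℓ) := by
    intro ℓ
    refine IsBigO.of_bound 1 ?_
    filter_upwards [eventually_pi_pos d] with φ hφ
    have h1 : ∀ k, 0 < ν k (φ k) := fun k => (hA k).ν_pos _ (hφ k)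
    rw [one_mul, Real.norm_of_nonneg (h1 ℓ).le,
      Real.norm_of_nonneg (Finset.sum_nonneg fun k _ => (h1 k).le)]
    exact Finset.single_le_sum (f := fun k => ν k (φ k)) (fun k _ => (h1 k).le)
      (Finset.mem_univ ℓ)
  have h := isLittleO_prod_one_add (tendsto_sum_ν hA)
    (n := fun ℓ (φ : Fin d → ℝ) => ν ℓ (φ ℓ) * D ℓ i j)
    (e := fun ℓ (φ : Fin d → ℝ) => corrMatrix (r ℓ) (fun i => x i ℓ) (φ ℓ) i j - 1)
    (fun ℓ => by simpa [mul_comm] using (hν ℓ).const_mul_left (D ℓ i j))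
    (fun ℓ => by
      refine IsLittleO.trans_isBigO ?_ (hν ℓ)
      have h1 : (fun φ => corrMatrix (r ℓ) (fun i => x i ℓ) φ i j - 1 - ν ℓ φ * D ℓ i j)
          =o[atTop] ν ℓ := by
        refine isLittleO_of_tendsto' ?_ ?_
        · filter_upwards [eventually_gt_atTop 0] with φ hφ h
          exact absurd h ((hA ℓ).ν_pos φ hφ).ne'
        · have h2 := ((hA ℓ).tendsto_entry i j).sub_const (D ℓ i j)
          rw [sub_self] at h2
          refine h2.congr' ?_
          filter_upwards [eventually_gt_atTop 0] with φ hφ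
          have := ((hA ℓ).ν_pos φ hφ).ne'
          field_simp
      exact h1.comp_tendsto (tendsto_eval_pi _ ℓ)) Finset.univ
  simpa [prodCorr] using h

theorem exists_flatLike_prodCorr (hr : ∀ ℓ, IsCorrelationFunction (r ℓ))
    (hA : ∀ ℓ, CorrelationAssumption (r ℓ) (fun i => x i ℓ) (ν ℓ) (ω ℓ) (D ℓ) (Dstar ℓ) (B ℓ)) :
    ∃ a b : ℝ, 0 < a ∧ 0 < b ∧ ∀ᶠ φ in Filter.pi fun _ : Fin d => (atTop : Filter ℝ),
      FlatLike a b (∑ ℓ, ν ℓ (φ ℓ)) (prodCorr r x φ) := by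
  obtain ⟨k, hk⟩ := (eventually_all.2 fun ℓ =>
    finsler (D ℓ) (1 : ι → ℝ) ((hA ℓ).D_pos (hr ℓ))).exists
  set κ : ℝ := 1 / ((k : ℝ) + 1) with hκ
  have hκ0 : 0 < κ := by positivity
  set N : ℝ := (Fintype.card ι : ℝ) with hN
  have hN0 : 0 ≤ N := by positivity
  obtain ⟨M, hM⟩ : ∃ M : ℝ, ∀ ℓ i j, |D ℓ i j| ≤ M := by
    obtain ⟨M, hM⟩ := (Set.finite_range
      fun p : Fin d × ι × ι => |D p.1 p.2.1 p.2.2|).bddAbove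
    exact ⟨M, fun ℓ i j => hM ⟨(ℓ, i, j), rfl⟩⟩
  have hM0 : 0 ≤ |M| := abs_nonneg M
  refine ⟨κ / 2, |M| * N + κ / 2, by positivity, by positivity, ?_⟩
  -- Chosen so that the remainder form costs at most half of Finsler's gain κw|u|²; N + 1 avoids
  -- dividing by zero when there are no points.
  have hε : 0 < κ / (2 * (N + 1)) := by positivity
  have hE : ∀ᶠ φ in Filter.pi fun _ : Fin d => (atTop : Filter ℝ), ∀ i j,
      ‖prodCorr r x φ i j - 1 - ∑ ℓ, ν ℓ (φ ℓ) * D ℓ i j‖ ≤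
        κ / (2 * (N + 1)) * ‖∑ ℓ, ν ℓ (φ ℓ)‖ :=
    eventually_all.2 fun i => eventually_all.2 fun j => (isLittleO_prodCorr hA i j).def hε
  -- Finsler's lemma costs kw(1·u)², which for small w is at most half of the term (1·u)² coming
  -- from 11ᵀ.
  have hkw : ∀ᶠ φ in Filter.pi fun _ : Fin d => (atTop : Filter ℝ),
      k * ∑ ℓ, ν ℓ (φ ℓ) < 1 / 2 := by
    have := (tendsto_sum_ν hA).const_mul (k : ℝ)
    rw [mul_zero] at this
    exact this.eventually (gt_mem_nhds (by norm_num))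
  filter_upwards [hE, hkw, eventually_pi_pos d] with φ hE hkw hφ u
  have hν : ∀ ℓ, 0 < ν ℓ (φ ℓ) := fun ℓ => (hA ℓ).ν_pos _ (hφ ℓ)
  have hw0 : 0 ≤ ∑ ℓ, ν ℓ (φ ℓ) := Finset.sum_nonneg fun ℓ _ => (hν ℓ).le
  rw [Real.norm_of_nonneg hw0] at hE
  set w := ∑ ℓ, ν ℓ (φ ℓ) with hw
  set E : Matrix ι ι ℝ := Matrix.of fun i j =>
    prodCorr r x φ i j - 1 - ∑ ℓ, ν ℓ (φ ℓ) * D ℓ i j with hEdef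
  have huu := dotProduct_self_nonneg' u
  have hEu : |u ⬝ᵥ (E *ᵥ u)| ≤ κ / 2 * w * (u ⬝ᵥ u) := by
    refine (abs_dotProduct_mulVec_le (E := E) (fun i j => hE i j) u).trans ?_
    refine mul_le_mul_of_nonneg_right ?_ huu
    rw [← hN]
    have : κ / (2 * (N + 1)) * w * N = κ / 2 * w * (N / (N + 1)) := by field_simp
    rw [this]
    exact mul_le_of_le_one_right (by positivity) ((div_le_one (by positivity)).2 (by linarith))
  have hsplit : u ⬝ᵥ (prodCorr r x φ *ᵥ u) = ((1 : ι → ℝ) ⬝ᵥ u) ^ 2 +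
      ∑ ℓ, ν ℓ (φ ℓ) * (u ⬝ᵥ (D ℓ *ᵥ u)) + u ⬝ᵥ (E *ᵥ u) := by
    have h1 : prodCorr r x φ = Matrix.vecMulVec 1 1 + ∑ ℓ, ν ℓ (φ ℓ) • D ℓ + E := by
      ext i j
      simp [hEdef, Matrix.sum_apply]
    have h2 : Matrix.vecMulVec (1 : ι → ℝ) 1 *ᵥ u = ((1 : ι → ℝ) ⬝ᵥ u) • (1 : ι → ℝ) := by
      ext i
      simp [Matrix.mulVec, dotProduct, Matrix.vecMulVec_apply]
    conv_lhs => rw [h1]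
    rw [Matrix.add_mulVec, Matrix.add_mulVec, dotProduct_add, dotProduct_add, h2,
      Matrix.sum_mulVec, dotProduct_sum, dotProduct_smul, dotProduct_comm u 1, sq, smul_eq_mul]
    simp only [Matrix.smul_mulVec, dotProduct_smul, smul_eq_mul]
  have hlow : κ * w * (u ⬝ᵥ u) ≤ ∑ ℓ, ν ℓ (φ ℓ) * (u ⬝ᵥ (D ℓ *ᵥ u)) +
      k * w * ((1 : ι → ℝ) ⬝ᵥ u) ^ 2 := by
    have : ∀ ℓ, ν ℓ (φ ℓ) * (κ * (u ⬝ᵥ u)) ≤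
        ν ℓ (φ ℓ) * (u ⬝ᵥ (D ℓ *ᵥ u) + k * ((1 : ι → ℝ) ⬝ᵥ u) ^ 2) :=
      fun ℓ => mul_le_mul_of_nonneg_left (hk ℓ u) (hν ℓ).le
    have h2 := Finset.sum_le_sum fun ℓ (_ : ℓ ∈ Finset.univ) => this ℓ
    simp only [mul_add, Finset.sum_add_distrib] at h2
    rw [← Finset.sum_mul, ← Finset.sum_mul, ← hw] at h2
    linarith
  have hup : ∑ ℓ, ν ℓ (φ ℓ) * (u ⬝ᵥ (D ℓ *ᵥ u)) ≤ |M| * N * w * (u ⬝ᵥ u) := by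
    have : ∀ ℓ, ν ℓ (φ ℓ) * (u ⬝ᵥ (D ℓ *ᵥ u)) ≤ ν ℓ (φ ℓ) * (|M| * N * (u ⬝ᵥ u)) :=
      fun ℓ => mul_le_mul_of_nonneg_left ((le_abs_self _).trans
        (abs_dotProduct_mulVec_le (fun i j => (hM ℓ i j).trans (le_abs_self M)) u)) (hν ℓ).le
    have h2 := Finset.sum_le_sum fun ℓ (_ : ℓ ∈ Finset.univ) => this ℓ
    rw [← Finset.sum_mul, ← hw] at h2
    linarith
  have hE1 := (abs_le.1 hEu).1
  have hE2 := (abs_le.1 hEu).2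
  rw [hsplit]
  constructor
  · have h3 := mul_le_mul_of_nonneg_right hkw.le (sq_nonneg ((1 : ι → ℝ) ⬝ᵥ u))
    linarith
  · linarith

end ProductCorrelation

/-! ### Integrating out the location and scale parameters. -/

section Integration

theorem lintegral_fin_prod {n : ℕ} {E : Fin n → Type} {mE : ∀ i, MeasurableSpace (E i)}
    {μ : (i : Fin n) → Measure (E i)} [∀ i, SigmaFinite (μ i)] {f : (i : Fin n) → E i → ENNReal}
    (hf : ∀ i, Measurable (f i)) :
    ∫⁻ x : (i : Fin n) → E i, ∏ i, f i (x i) ∂(Measure.pi μ) = ∏ i, ∫⁻ x, f i x ∂(μ i) := by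
  induction n with
  | zero => simp
  | succ n ih =>
    calc
      _ = ∫⁻ x : E 0 × ((i : Fin n) → E (Fin.succ i)),
            f 0 x.1 * ∏ i : Fin n, f (Fin.succ i) (x.2 i)
            ∂((μ 0).prod (Measure.pi (fun i ↦ μ i.succ))) := by
          rw [← ((measurePreserving_piFinSuccAbove μ 0).symm).lintegral_comp_emb
            (MeasurableEquiv.measurableEmbedding _)]
          simp_rw [MeasurableEquiv.piFinSuccAbove_symm_apply, Fin.insertNthEquiv,
            Fin.prod_univ_succ, Fin.insertNth_zero]
          rfl
      _ = (∫⁻ x, f 0 x ∂μ 0) * ∏ i : Fin n, ∫⁻ (x : E (Fin.succ i)), f (Fin.succ i) x ∂(μ i.succ) := by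
          have hm : Measurable fun x : (i : Fin n) → E (Fin.succ i) =>
              ∏ i : Fin n, f (Fin.succ i) (x i) :=
            Finset.measurable_fun_prod _ fun i _ => (hf _).comp (measurable_pi_apply i)
          rw [← ih fun i => hf _]
          exact lintegral_prod_mul (hf 0).aemeasurable hm.aemeasurable
      _ = ∏ i, ∫⁻ x, f i x ∂(μ i) := by rw [Fin.prod_univ_succ]

set_option linter.unusedSectionVars false

variable {ι κ : Type} [Fintype ι] [DecidableEq ι] [Fintype κ] [DecidableEq κ]

theorem lintegral_exp_neg_dotProduct_self (κ : Type) [Fintype κ] :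
    ∫⁻ b : κ → ℝ, ENNReal.ofReal (Real.exp (-(b ⬝ᵥ b) / 2)) =
      ENNReal.ofReal ((2 * Real.pi) ^ ((Fintype.card κ : ℝ) / 2)) := by
  have e : ∀ b : κ → ℝ, Real.exp (-(b ⬝ᵥ b) / 2) = ∏ i, Real.exp (-(1 / 2) * b i ^ 2) := by
    intro b
    rw [← Real.exp_sum]
    congr 1
    rw [dotProduct, neg_div, Finset.sum_div, ← Finset.sum_neg_distrib]
    exact Finset.sum_congr rfl fun i _ => by ring
  have hi : Integrable (fun b : κ → ℝ => ∏ i, Real.exp (-(1 / 2) * b i ^ 2)) :=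
    Integrable.fintype_prod (f := fun _ : κ => fun t : ℝ => Real.exp (-(1 / 2) * t ^ 2))
      fun _ => integrable_exp_neg_mul_sq (by norm_num)
  simp only [e]
  rw [← ofReal_integral_eq_lintegral_ofReal hi
    (ae_of_all _ fun b => Finset.prod_nonneg fun i _ => (Real.exp_pos _).le),
    integral_fintype_prod_volume_eq_pow (fun t : ℝ => Real.exp (-(1 / 2) * t ^ 2)),
    integral_gaussian]
  congr 1
  rw [Real.sqrt_eq_rpow, ← Real.rpow_natCast, ← Real.rpow_mul (by positivity)]
  congr 1 <;> ring

/-- The Gaussian integral for a positive definite quadratic form. -/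
theorem lintegral_exp_neg_quadratic {A : Matrix κ κ ℝ} (hA : A.PosDef) :
    ∫⁻ b : κ → ℝ, ENNReal.ofReal (Real.exp (-(b ⬝ᵥ (A *ᵥ b)) / 2)) =
      ENNReal.ofReal ((2 * Real.pi) ^ ((Fintype.card κ : ℝ) / 2) * A.det ^ (-(1 / 2) : ℝ)) := by
  obtain ⟨C, hC, hC0⟩ := hA.exists_eq_transpose_mul_self
  have e : ∀ b : κ → ℝ, b ⬝ᵥ (A *ᵥ b) = (C *ᵥ b) ⬝ᵥ (C *ᵥ b) := by
    intro b
    rw [hC, ← Matrix.mulVec_mulVec, Matrix.dotProduct_mulVec, Matrix.vecMul_transpose]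
  have hm : Measurable (Matrix.toLin' C) := (LinearMap.continuous_of_finiteDimensional _).measurable
  have hg : Measurable fun b : κ → ℝ => ENNReal.ofReal (Real.exp (-(b ⬝ᵥ b) / 2)) := by
    have : Continuous fun b : κ → ℝ => b ⬝ᵥ b := continuous_id.dotProduct continuous_id
    exact ENNReal.measurable_ofReal.comp (by fun_prop)
  have h1 := lintegral_map (μ := volume) hg hm
  rw [Real.map_matrix_volume_pi_eq_smul_volume_pi hC0, lintegral_smul_measure,
    lintegral_exp_neg_dotProduct_self] at h1
  simp only [e]
  simp only [Matrix.toLin'_apply] at h1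
  rw [← h1, smul_eq_mul, ← ENNReal.ofReal_mul (abs_nonneg _), mul_comm]
  congr 2
  have hdet : A.det = |C.det| ^ (2 : ℝ) := by
    rw [hC, Matrix.det_mul, Matrix.det_transpose, Real.rpow_two, sq_abs, sq]
  rw [hdet, ← Real.rpow_mul (abs_nonneg _), abs_inv]
  norm_num [Real.rpow_neg_one]

/-- The inverse-gamma integral. -/
theorem lintegral_inverse_gamma {e c : ℝ} (he : 0 < e) (hc : 0 < c) :
    ∫⁻ t in Set.Ioi (0 : ℝ), ENNReal.ofReal (t ^ (-e - 1) * Real.exp (-(c / t))) =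
      ENNReal.ofReal (c ^ (-e) * Real.Gamma e) := by
  -- The substitution t ↦ 1/t turns the integral into the Gamma integral of g.
  let g : ℝ → ℝ := fun t => t ^ (e - 1) * Real.exp (-(c * t))
  have hg : ∫ t in Set.Ioi (0 : ℝ), g t = c ^ (-e) * Real.Gamma e := by
    rw [Real.integral_rpow_mul_exp_neg_mul_Ioi he hc, one_div, Real.inv_rpow hc.le,
      Real.rpow_neg hc.le]
  have hgi : IntegrableOn g (Set.Ioi 0) := by
    have h := integrableOn_rpow_mul_exp_neg_mul_rpow (p := 1) (s := e - 1) (by linarith) one_pos hc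
    refine h.congr_fun (fun t _ => ?_) measurableSet_Ioi
    simp only [Real.rpow_one, g]
    ring_nf
  have heq : ∀ t ∈ Set.Ioi (0 : ℝ), (|(-1 : ℝ)| * t ^ ((-1 : ℝ) - 1)) • g (t ^ (-1 : ℝ)) =
      t ^ (-e - 1) * Real.exp (-(c / t)) := by
    intro t ht
    have ht' : (0 : ℝ) < t := ht
    simp only [g, smul_eq_mul, abs_neg, abs_one, one_mul]
    rw [← Real.rpow_mul ht'.le, ← mul_assoc, ← Real.rpow_add ht', Real.rpow_neg_one,
      div_eq_mul_inv]
    congr 2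
    ring
  have h1 := integral_comp_rpow_Ioi g (by norm_num : (-1 : ℝ) ≠ 0)
  have h2 := (integrableOn_Ioi_comp_rpow_iff g (by norm_num : (-1 : ℝ) ≠ 0)).2 hgi
  rw [setIntegral_congr_fun measurableSet_Ioi heq] at h1
  have h3 := h2.congr_fun heq measurableSet_Ioi
  rw [← hg, ← h1, ofReal_integral_eq_lintegral_ofReal h3]
  filter_upwards [ae_restrict_mem measurableSet_Ioi] with t ht
  have ht' : (0 : ℝ) < t := ht
  simp only [Pi.zero_apply]
  positivity

variable {X : Matrix ι κ ℝ} {y : ι → ℝ}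

/-- Completing the square in the generalised sum of squares. -/
theorem quadratic_eq_residualForm_add (hX : LinearIndependent ℝ X.col) {R : Matrix ι ι ℝ}
    (hR : R.PosDef) (y : ι → ℝ) : ∃ b₀ : κ → ℝ, ∀ b : κ → ℝ,
      (y - X *ᵥ b) ⬝ᵥ (R⁻¹ *ᵥ (y - X *ᵥ b)) =
        residualForm X y R + (b - b₀) ⬝ᵥ ((Xᵀ * R⁻¹ * X) *ᵥ (b - b₀)) := by
  have hA := hR.inv.transpose_mul_mul (mulVec_injective_of_col hX)
  set A := Xᵀ * R⁻¹ * X with hAdef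
  set b₀ := A⁻¹ *ᵥ ((Xᵀ * R⁻¹) *ᵥ y) with hb₀
  have hsymm : ∀ u w : ι → ℝ, u ⬝ᵥ (R⁻¹ *ᵥ w) = w ⬝ᵥ (R⁻¹ *ᵥ u) := by
    intro u w
    rw [Matrix.dotProduct_mulVec, ← Matrix.mulVec_transpose, hR.inv.transpose_eq, dotProduct_comm]
  have hAb : A *ᵥ b₀ = (Xᵀ * R⁻¹) *ᵥ y := by
    rw [hb₀, Matrix.mulVec_mulVec, Matrix.mul_nonsing_inv _ hA.isUnit_det, Matrix.one_mulVec]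
  have hXe : ∀ (v : κ → ℝ) (u : ι → ℝ), (X *ᵥ v) ⬝ᵥ (R⁻¹ *ᵥ u) = v ⬝ᵥ ((Xᵀ * R⁻¹) *ᵥ u) := by
    intro v u
    rw [← Matrix.mulVec_mulVec, Matrix.dotProduct_mulVec v, Matrix.vecMul_transpose]
  have hres : residualForm X y R = y ⬝ᵥ (R⁻¹ *ᵥ (y - X *ᵥ b₀)) := by
    rw [residualForm, ← Matrix.mulVec_mulVec, Matrix.sub_mulVec, Matrix.one_mulVec, hb₀]
    simp only [Matrix.mulVec_mulVec, Matrix.mul_assoc, hAdef]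
  have hperp : ∀ v : κ → ℝ, (X *ᵥ v) ⬝ᵥ (R⁻¹ *ᵥ (y - X *ᵥ b₀)) = 0 := by
    intro v
    rw [hXe, Matrix.mulVec_sub, Matrix.mulVec_mulVec, ← hAdef, hAb, sub_self, dotProduct_zero]
  refine ⟨b₀, fun b => ?_⟩
  have hdec : y - X *ᵥ b = (y - X *ᵥ b₀) - X *ᵥ (b - b₀) := by
    rw [Matrix.mulVec_sub]
    abel
  have hAquad : ∀ v : κ → ℝ, v ⬝ᵥ (A *ᵥ v) = (X *ᵥ v) ⬝ᵥ (R⁻¹ *ᵥ (X *ᵥ v)) := by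
    intro v
    rw [hXe, Matrix.mulVec_mulVec]
  rw [hdec]
  generalize b - b₀ = v
  have h1 : (y - X *ᵥ b₀) ⬝ᵥ (R⁻¹ *ᵥ (y - X *ᵥ b₀)) = residualForm X y R := by
    rw [sub_dotProduct y, hperp, sub_zero, hres]
  have h2 := hperp v
  have h3 := hsymm (y - X *ᵥ b₀) (X *ᵥ v)
  rw [hAquad, ← h1]
  rw [h2] at h3
  rw [Matrix.mulVec_sub R⁻¹ _ (X *ᵥ v), dotProduct_sub, sub_dotProduct _ (X *ᵥ v),
    sub_dotProduct _ (X *ᵥ v), h2, h3]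
  ring

theorem gaussianDensity_smul (R : Matrix ι ι ℝ) (hR : R.PosDef) {σ : ℝ} (hσ : 0 < σ)
    (m y : ι → ℝ) : gaussianDensity m (σ • R) y =
      (2 * Real.pi) ^ (-(Fintype.card ι : ℝ) / 2) * R.det ^ (-(1 / 2) : ℝ) *
        (σ ^ (-(Fintype.card ι : ℝ) / 2) *
          Real.exp (-((y - m) ⬝ᵥ (R⁻¹ *ᵥ (y - m))) / 2 / σ)) := by
  have h1 : (σ • R)⁻¹ = σ⁻¹ • R⁻¹ := by
    refine Matrix.inv_eq_right_inv ?_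
    rw [Matrix.smul_mul, Matrix.mul_smul, Matrix.mul_nonsing_inv _ hR.isUnit_det, smul_smul,
      mul_inv_cancel₀ hσ.ne', one_smul]
  have h2 : (σ ^ Fintype.card ι) ^ (-(1 / 2) : ℝ) = σ ^ (-(Fintype.card ι : ℝ) / 2) := by
    rw [← Real.rpow_natCast, ← Real.rpow_mul hσ.le]
    congr 1
    ring
  have h3 : -((y - m) ⬝ᵥ (σ⁻¹ • R⁻¹ *ᵥ (y - m))) / 2 =
      -((y - m) ⬝ᵥ (R⁻¹ *ᵥ (y - m))) / 2 / σ := by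
    rw [dotProduct_smul, smul_eq_mul]
    ring
  rw [gaussianDensity, h1, Matrix.det_smul, Real.mul_rpow (by positivity) hR.det_pos.le, h2,
    Matrix.smul_mulVec, h3]
  ring

theorem lintegral_gaussianDensity (hX : LinearIndependent ℝ X.col) {R : Matrix ι ι ℝ}
    (hR : R.PosDef) {σ : ℝ} (hσ : 0 < σ) :
    ∫⁻ b : κ → ℝ, ENNReal.ofReal (gaussianDensity (X *ᵥ b) (σ • R) y) =
      ENNReal.ofReal ((2 * Real.pi) ^ (-((Fintype.card ι : ℝ) - Fintype.card κ) / 2) *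
        R.det ^ (-(1 / 2) : ℝ) * (Xᵀ * R⁻¹ * X).det ^ (-(1 / 2) : ℝ) *
          (σ ^ (-((Fintype.card ι : ℝ) - Fintype.card κ) / 2) *
            Real.exp (-(residualForm X y R / 2 / σ)))) := by
  have hA := hR.inv.transpose_mul_mul (mulVec_injective_of_col hX)
  obtain ⟨b₀, hb₀⟩ := quadratic_eq_residualForm_add hX hR y
  set A := Xᵀ * R⁻¹ * X
  set n : ℝ := (Fintype.card ι : ℝ)
  set q : ℝ := (Fintype.card κ : ℝ) with hq
  set c : ℝ := (2 * Real.pi) ^ (-n / 2) * R.det ^ (-(1 / 2) : ℝ) *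
    (σ ^ (-n / 2) * Real.exp (-(residualForm X y R / 2 / σ)))
  have hRd := hR.det_pos
  have hc : 0 ≤ c := by positivity
  have e1 : ∀ b : κ → ℝ, ENNReal.ofReal (gaussianDensity (X *ᵥ b) (σ • R) y) =
      ENNReal.ofReal c *
        ENNReal.ofReal (Real.exp (-((b - b₀) ⬝ᵥ ((σ⁻¹ • A) *ᵥ (b - b₀))) / 2)) := by
    intro b
    rw [gaussianDensity_smul R hR hσ, hb₀, ← ENNReal.ofReal_mul hc]
    have : -(residualForm X y R + (b - b₀) ⬝ᵥ (A *ᵥ (b - b₀))) / 2 / σ =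
        -(residualForm X y R / 2 / σ) + -((b - b₀) ⬝ᵥ ((σ⁻¹ • A) *ᵥ (b - b₀))) / 2 := by
      rw [Matrix.smul_mulVec, dotProduct_smul, smul_eq_mul]
      field_simp
      ring
    rw [this, Real.exp_add]
    congr 1
    ring
  simp only [e1]
  rw [lintegral_const_mul' _ _ ENNReal.ofReal_ne_top,
    lintegral_sub_right_eq_self
      (fun b : κ → ℝ => ENNReal.ofReal (Real.exp (-(b ⬝ᵥ ((σ⁻¹ • A) *ᵥ b)) / 2))) b₀,
    lintegral_exp_neg_quadratic (hA.smul (inv_pos.2 hσ)), ← ENNReal.ofReal_mul hc]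
  congr 1
  have h2 : (σ⁻¹ • A).det ^ (-(1 / 2) : ℝ) = σ ^ (q / 2) * A.det ^ (-(1 / 2) : ℝ) := by
    rw [Matrix.det_smul, Real.mul_rpow (by positivity) hA.det_pos.le, inv_pow, Real.inv_rpow
      (by positivity), ← Real.rpow_neg (by positivity), ← Real.rpow_natCast,
      ← Real.rpow_mul hσ.le, ← hq]
    congr 2
    ring
  have h3 : (2 * Real.pi) ^ (-(n - q) / 2) = (2 * Real.pi) ^ (-n / 2) * (2 * Real.pi) ^ (q / 2) := by
    rw [← Real.rpow_add (by positivity)]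
    congr 1
    ring
  have h4 : σ ^ (-(n - q) / 2) = σ ^ (-n / 2) * σ ^ (q / 2) := by
    rw [← Real.rpow_add hσ]
    congr 1
    ring
  rw [h2, h3, h4]
  ring

theorem measurable_gaussian_aux (X : Matrix ι κ ℝ) (y : ι → ℝ) (R : Matrix ι ι ℝ) (c n a : ℝ) :
    Measurable fun θ : (κ → ℝ) × ℝ => ENNReal.ofReal (c * (θ.2 ^ n *
      Real.exp (-((y - X *ᵥ θ.1) ⬝ᵥ (R⁻¹ *ᵥ (y - X *ᵥ θ.1))) / 2 / θ.2)) / θ.2 ^ a) := by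
  have h1 : Continuous fun b : κ → ℝ => y - X *ᵥ b :=
    continuous_const.sub (continuous_const.matrix_mulVec continuous_id)
  have h2 : Continuous fun b : κ → ℝ => (y - X *ᵥ b) ⬝ᵥ (R⁻¹ *ᵥ (y - X *ᵥ b)) :=
    h1.dotProduct (continuous_const.matrix_mulVec h1)
  have h3 : Measurable fun θ : (κ → ℝ) × ℝ =>
      (y - X *ᵥ θ.1) ⬝ᵥ (R⁻¹ *ᵥ (y - X *ᵥ θ.1)) := h2.measurable.comp measurable_fst
  fun_prop

/-- The integrand of the location-scale integral of one level, in a manifestly measurable form. -/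
theorem gaussianDensity_div_eq {R : Matrix ι ι ℝ} (hR : R.PosDef) (a : ℝ) {θ : (κ → ℝ) × ℝ}
    (hθ : 0 < θ.2) :
    ENNReal.ofReal (gaussianDensity (X *ᵥ θ.1) (θ.2 • R) y / θ.2 ^ a) =
      ENNReal.ofReal ((2 * Real.pi) ^ (-(Fintype.card ι : ℝ) / 2) * R.det ^ (-(1 / 2) : ℝ) *
        (θ.2 ^ (-(Fintype.card ι : ℝ) / 2) *
          Real.exp (-((y - X *ᵥ θ.1) ⬝ᵥ (R⁻¹ *ᵥ (y - X *ᵥ θ.1))) / 2 / θ.2)) / θ.2 ^ a) := by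
  rw [gaussianDensity_smul R hR hθ]

/-- The Gaussian integral over b comes first and leaves σ^(−e−1) exp(−S²/(2σ)), where σ stands for
the variance; the inverse-gamma integral then gives Γ(e)(S²/2)^(−e). -/
theorem lintegral_level (hX : LinearIndependent ℝ X.col)
    (hy : y ∉ LinearMap.range X.mulVecLin) {R : Matrix ι ι ℝ} (hR : R.PosDef) {a : ℝ}
    (he : 0 < ((Fintype.card ι : ℝ) - Fintype.card κ) / 2 + a - 1) :
    ∫⁻ θ : (κ → ℝ) × ℝ, ENNReal.ofReal
        ((2 * Real.pi) ^ (-(Fintype.card ι : ℝ) / 2) * R.det ^ (-(1 / 2) : ℝ) *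
        (θ.2 ^ (-(Fintype.card ι : ℝ) / 2) *
          Real.exp (-((y - X *ᵥ θ.1) ⬝ᵥ (R⁻¹ *ᵥ (y - X *ᵥ θ.1))) / 2 / θ.2)) / θ.2 ^ a)
        ∂(volume.restrict (Set.univ ×ˢ Set.Ioi 0)) =
      ENNReal.ofReal ((2 * Real.pi) ^ (-((Fintype.card ι : ℝ) - Fintype.card κ) / 2) *
        2 ^ (((Fintype.card ι : ℝ) - Fintype.card κ) / 2 + a - 1) *
        Real.Gamma (((Fintype.card ι : ℝ) - Fintype.card κ) / 2 + a - 1) *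
        levelFactor X y (((Fintype.card ι : ℝ) - Fintype.card κ) / 2 + a - 1) R) := by
  have hA := (hR.inv.transpose_mul_mul (mulVec_injective_of_col hX)).det_pos
  have hS := residualForm_pos hX hy hR
  have hRd := hR.det_pos
  rw [Measure.volume_eq_prod, ← Measure.prod_restrict,
    lintegral_prod_symm' _ (measurable_gaussian_aux X y R _ _ a)]
  set e := ((Fintype.card ι : ℝ) - Fintype.card κ) / 2 + a - 1 with he'
  set c := (2 * Real.pi) ^ (-((Fintype.card ι : ℝ) - Fintype.card κ) / 2) *
        R.det ^ (-(1 / 2) : ℝ) * (Xᵀ * R⁻¹ * X).det ^ (-(1 / 2) : ℝ) with hcdef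
  have hc : 0 ≤ c := by positivity
  have hinner : ∀ σ ∈ Set.Ioi (0 : ℝ), ∫⁻ b : κ → ℝ, ENNReal.ofReal
        ((2 * Real.pi) ^ (-(Fintype.card ι : ℝ) / 2) * R.det ^ (-(1 / 2) : ℝ) *
        (σ ^ (-(Fintype.card ι : ℝ) / 2) *
          Real.exp (-((y - X *ᵥ b) ⬝ᵥ (R⁻¹ *ᵥ (y - X *ᵥ b))) / 2 / σ)) / σ ^ a)
        ∂(volume.restrict Set.univ) =
      ENNReal.ofReal c * ENNReal.ofReal (σ ^ (-e - 1) *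
        Real.exp (-(residualForm X y R / 2 / σ))) := by
    intro σ hσ
    have hσ' : (0 : ℝ) < σ := hσ
    have hσa : 0 ≤ (σ ^ a)⁻¹ := by positivity
    have h1 : ∀ b : κ → ℝ, ENNReal.ofReal
        ((2 * Real.pi) ^ (-(Fintype.card ι : ℝ) / 2) * R.det ^ (-(1 / 2) : ℝ) *
        (σ ^ (-(Fintype.card ι : ℝ) / 2) *
          Real.exp (-((y - X *ᵥ b) ⬝ᵥ (R⁻¹ *ᵥ (y - X *ᵥ b))) / 2 / σ)) / σ ^ a) =
        ENNReal.ofReal ((σ ^ a)⁻¹) * ENNReal.ofReal (gaussianDensity (X *ᵥ b) (σ • R) y) := by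
      intro b
      rw [gaussianDensity_smul R hR hσ', ← ENNReal.ofReal_mul hσa, div_eq_inv_mul]
    simp only [h1]
    rw [Measure.restrict_univ, lintegral_const_mul' _ _ ENNReal.ofReal_ne_top,
      lintegral_gaussianDensity hX hR hσ', ← ENNReal.ofReal_mul hσa, ← ENNReal.ofReal_mul hc]
    congr 1
    have h2 : σ ^ (-e - 1) =
        σ ^ (-((Fintype.card ι : ℝ) - Fintype.card κ) / 2) * (σ ^ a)⁻¹ := by
      rw [← Real.rpow_neg hσ'.le, ← Real.rpow_add hσ']
      congr 1
      rw [he']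
      ring
    rw [h2]
    ring
  rw [setLIntegral_congr_fun measurableSet_Ioi hinner,
    lintegral_const_mul' _ _ ENNReal.ofReal_ne_top, lintegral_inverse_gamma he (by positivity),
    ← ENNReal.ofReal_mul hc]
  congr 1
  rw [levelFactor, Real.div_rpow hS.le zero_le_two, Real.rpow_neg zero_le_two e, hcdef]
  field_simp

end Integration

/-! ### Divergent integrals and the asymptotics of one level. -/

section Auxiliary

theorem exists_forall_of_eventually_pi_atTop {d : ℕ} {P : (Fin d → ℝ) → Prop}
    (h : ∀ᶠ φ in Filter.pi fun _ : Fin d => (atTop : Filter ℝ), P φ) :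
    ∃ N : ℝ, ∀ φ : Fin d → ℝ, (∀ ℓ, N < φ ℓ) → P φ := by
  obtain ⟨I, -, t, ht, hsub⟩ := Filter.mem_pi.1 h
  choose N hN using fun ℓ => Filter.mem_atTop_sets.1 (ht ℓ)
  obtain ⟨b, hb⟩ := (Set.finite_range N).bddAbove
  exact ⟨b, fun φ hφ => hsub fun ℓ _ => hN ℓ _ ((hb ⟨ℓ, rfl⟩).trans (hφ ℓ).le)⟩

theorem setLIntegral_inv_eq_top {I : Set ℝ} (hI : MeasurableSet I) (hpos : ∀ x ∈ I, 0 < x)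
    (h : ¬ IntegrableOn (fun x : ℝ => x⁻¹) I) :
    ∫⁻ x in I, ENNReal.ofReal x⁻¹ = ⊤ := by
  by_contra hne
  refine h ⟨measurable_inv.aestronglyMeasurable, ?_⟩
  rw [hasFiniteIntegral_iff_ofReal]
  · exact lt_top_iff_ne_top.2 hne
  · filter_upwards [ae_restrict_mem hI] with x hx
    exact (inv_pos.2 (hpos x hx)).le

theorem not_integrableOn_Ioo_inv {ε : ℝ} (hε : 0 < ε) :
    ¬ IntegrableOn (fun x : ℝ => x⁻¹) (Set.Ioo 0 ε) := by
  have h := (intervalIntegral.integrableOn_Ioo_rpow_iff (s := -1) hε).not.2 (lt_irrefl _)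
  simpa only [Real.rpow_neg_one] using h

theorem gaussianDensity_nonneg {ι : Type} [Fintype ι] [DecidableEq ι] (m y : ι → ℝ)
    {C : Matrix ι ι ℝ} (hC : 0 ≤ C.det) : 0 ≤ gaussianDensity m C y := by
  rw [gaussianDensity]
  positivity

end Auxiliary

section Levels

variable {ι κ : Type} [Fintype ι] [DecidableEq ι] [Fintype κ] [DecidableEq κ] {d : ℕ}
  {X : Matrix ι κ ℝ} {y : ι → ℝ} {r : Fin d → ℝ → ℝ} {x : ι → Fin d → ℝ}
  {ν ω : Fin d → ℝ → ℝ} {D Dstar : Fin d → Matrix ι ι ℝ} {B : Fin d → ℝ → Matrix ι ι ℝ}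

open Classical in
theorem isBigO_levelFactor (hd : 0 < d) (hX : LinearIndependent ℝ X.col)
    (hy : y ∉ LinearMap.range X.mulVecLin ⊔ Submodule.span ℝ {(1 : ι → ℝ)})
    (hr : ∀ ℓ, IsCorrelationFunction (r ℓ))
    (hA : ∀ ℓ, CorrelationAssumption (r ℓ) (fun i => x i ℓ) (ν ℓ) (ω ℓ) (D ℓ) (Dstar ℓ) (B ℓ))
    (e : ℝ) :
    (fun φ => levelFactor X y e (prodCorr r x φ)) =O[Filter.pi fun _ => atTop]
      fun φ => (∑ ℓ, ν ℓ (φ ℓ)) ^ (e - ((Fintype.card ι : ℝ) - Fintype.card κ) / 2 + 1 -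
        if (1 : ι → ℝ) ∈ LinearMap.range X.mulVecLin then 1 else 1 / 2) := by
  obtain ⟨a, b, ha, hb, hF⟩ := exists_flatLike_prodCorr hr hA
  obtain ⟨C, hC, hle⟩ := exists_levelFactor_le hX hy ha hb e
  refine IsBigO.of_bound C ?_
  have : Nonempty (Fin d) := ⟨⟨0, hd⟩⟩
  filter_upwards [hF, eventually_pi_pos d] with φ hφ hpos
  have hR := prodCorr_posDef hd hr (fun ℓ => (hA ℓ).injective) hpos
  have hw : 0 < ∑ ℓ, ν ℓ (φ ℓ) :=
    Finset.sum_pos (fun ℓ _ => (hA ℓ).ν_pos _ (hpos ℓ)) Finset.univ_nonempty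
  rw [Real.norm_of_nonneg (levelFactor_pos hX (fun h => hy (Submodule.mem_sup_left h)) e hR).le,
    Real.norm_of_nonneg (Real.rpow_nonneg hw.le _)]
  exact hle _ _ hR hw hφ

/-- w^(1/2) ≥ ν_ℓ₀^(1/2) ≥ c/φ_ℓ₀ for one dimension ℓ₀. Weakening this to the product of all 1/φ_ℓ,
allowed once every φ_ℓ ≥ 1, gives a bound whose integral factorises. -/
theorem exists_prod_inv_le_levelFactor (hd : 0 < d) (hX : LinearIndependent ℝ X.col)
    (hy : y ∉ LinearMap.range X.mulVecLin)
    (hr : ∀ ℓ, IsCorrelationFunction (r ℓ))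
    (hA : ∀ ℓ, CorrelationAssumption (r ℓ) (fun i => x i ℓ) (ν ℓ) (ω ℓ) (D ℓ) (Dstar ℓ) (B ℓ)) :
    ∃ c N : ℝ, 0 < c ∧ ∀ φ : Fin d → ℝ, (∀ ℓ, N < φ ℓ) → c * ∏ ℓ, (φ ℓ)⁻¹ ≤
      levelFactor X y (((Fintype.card ι : ℝ) - Fintype.card κ) / 2) (prodCorr r x φ) := by
  have hne : Nonempty ι := by
    by_contra h
    rw [not_nonempty_iff] at h
    exact hy ⟨0, Subsingleton.elim _ _⟩
  let ℓ₀ : Fin d := ⟨0, hd⟩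
  obtain ⟨a, b, ha, hb, hF⟩ := exists_flatLike_prodCorr hr hA
  obtain ⟨c, hc, hle⟩ := exists_le_levelFactor hX hy ha hb
  obtain ⟨c', hc', hν⟩ := (hA ℓ₀).exists_div_sq_le (hr ℓ₀)
  have hone : ∀ᶠ φ in Filter.pi fun _ : Fin d => (atTop : Filter ℝ), ∀ ℓ, 1 ≤ φ ℓ :=
    eventually_all.2 fun ℓ => (tendsto_eval_pi _ ℓ).eventually (eventually_ge_atTop 1)
  have hev : ∀ᶠ φ in Filter.pi fun _ : Fin d => (atTop : Filter ℝ),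
      c * c' ^ (1 / 2 : ℝ) * ∏ ℓ, (φ ℓ)⁻¹ ≤
        levelFactor X y (((Fintype.card ι : ℝ) - Fintype.card κ) / 2) (prodCorr r x φ) := by
    filter_upwards [hF, hone, (tendsto_eval_pi _ ℓ₀).eventually hν,
      (tendsto_sum_ν hA).eventually (gt_mem_nhds one_pos)] with φ hφ h1 h2 hw1
    simp only [Function.eval] at h2
    have hpos : ∀ ℓ, 0 < φ ℓ := fun ℓ => one_pos.trans_le (h1 ℓ)
    have hν0 : ∀ ℓ, 0 < ν ℓ (φ ℓ) := fun ℓ => (hA ℓ).ν_pos _ (hpos ℓ)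
    have hR := prodCorr_posDef hd hr (fun ℓ => (hA ℓ).injective) hpos
    have hw' : ν ℓ₀ (φ ℓ₀) ≤ ∑ ℓ, ν ℓ (φ ℓ) :=
      Finset.single_le_sum (f := fun k => ν k (φ k)) (fun k _ => (hν0 k).le) (Finset.mem_univ ℓ₀)
    have hw : 0 < ∑ ℓ, ν ℓ (φ ℓ) := (hν0 ℓ₀).trans_le hw'
    refine le_trans ?_ (hle _ _ hR hw hw1.le hφ)
    rw [mul_assoc]
    refine mul_le_mul_of_nonneg_left ?_ hc.le
    have hprod : ∏ ℓ, (φ ℓ)⁻¹ ≤ (φ ℓ₀)⁻¹ := by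
      rw [← Finset.mul_prod_erase _ _ (Finset.mem_univ ℓ₀)]
      exact mul_le_of_le_one_right (inv_pos.2 (hpos ℓ₀)).le (Finset.prod_le_one
        (fun k _ => (inv_pos.2 (hpos k)).le) fun k _ => inv_le_one_of_one_le₀ (h1 k))
    calc c' ^ (1 / 2 : ℝ) * ∏ ℓ, (φ ℓ)⁻¹ ≤ c' ^ (1 / 2 : ℝ) * (φ ℓ₀)⁻¹ := by gcongr
      _ = (c' / φ ℓ₀ ^ 2) ^ (1 / 2 : ℝ) := by
          rw [Real.div_rpow hc'.le (by positivity), ← Real.sqrt_eq_rpow (φ ℓ₀ ^ 2),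
            Real.sqrt_sq (hpos ℓ₀).le]
          exact (div_eq_mul_inv _ _).symm
      _ ≤ _ := Real.rpow_le_rpow (by positivity) (h2.trans hw') (by norm_num)
  obtain ⟨N, hN⟩ := exists_forall_of_eventually_pi_atTop hev
  exact ⟨_, N, by positivity, hN⟩

end Levels

/-! ### Assembling the levels. -/

namespace CokrigingModel

variable {s d : ℕ} (M : CokrigingModel s d)

theorem integratedLikelihood_eq (a : Fin s → ℝ) (φ : Fin s → Fin d → ℝ) :
    M.integratedLikelihood a φ =
      ∏ t, levelFactor (M.X t) (M.y t) (M.expo a t) (M.R t (φ t)) := rfl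

variable {M}

theorem exists_locScaleIntegral_eq (hX : ∀ t, LinearIndependent ℝ (M.X t).col)
    (hy : ∀ t, M.y t ∉ M.colSpace t)
    (hR : ∀ φ : Fin s → Fin d → ℝ, (∀ t ℓ, 0 < φ t ℓ) → ∀ t, (M.R t (φ t)).PosDef)
    (a : Fin s → ℝ) (ha : ∀ t, 0 < M.expo a t) :
    ∃ C : ℝ, 0 < C ∧ ∀ φ : Fin s → Fin d → ℝ, (∀ t ℓ, 0 < φ t ℓ) →
      M.locScaleIntegral a φ = ENNReal.ofReal (C * M.integratedLikelihood a φ) := by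
  refine ⟨∏ t, ((2 * Real.pi) ^
      (-((Fintype.card (M.Row t) : ℝ) - Fintype.card (M.Col t)) / 2) *
    2 ^ M.expo a t * Real.Gamma (M.expo a t)), ?_, fun φ hφ => ?_⟩
  · refine Finset.prod_pos fun t _ => ?_
    have := Real.Gamma_pos_of_pos (ha t)
    positivity
  have hset : M.locScaleSet = Set.univ.pi fun _ => Set.univ ×ˢ Set.Ioi 0 := by
    ext θ
    simp [locScaleSet]
  let f : (t : Fin s) → (M.Col t → ℝ) × ℝ → ENNReal := fun t θ => ENNReal.ofReal
    ((2 * Real.pi) ^ (-(Fintype.card (M.Row t) : ℝ) / 2) *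
      (M.R t (φ t)).det ^ (-(1 / 2) : ℝ) * (θ.2 ^ (-(Fintype.card (M.Row t) : ℝ) / 2) *
      Real.exp (-((M.y t - M.X t *ᵥ θ.1) ⬝ᵥ ((M.R t (φ t))⁻¹ *ᵥ
        (M.y t - M.X t *ᵥ θ.1))) / 2 / θ.2)) / θ.2 ^ a t)
  have hf : ∀ t, Measurable (f t) := fun t => measurable_gaussian_aux _ _ _ _ _ _
  have hmeas : MeasurableSet M.locScaleSet := by
    rw [hset]
    exact MeasurableSet.univ_pi fun _ => MeasurableSet.univ.prod measurableSet_Ioi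
  have hcongr : ∀ θ ∈ M.locScaleSet,
      ENNReal.ofReal (M.likelihood θ φ / ∏ t, (θ t).2 ^ a t) = ∏ t, f t (θ t) := by
    intro θ hθ
    rw [likelihood, ← Finset.prod_div_distrib, ENNReal.ofReal_prod_of_nonneg]
    · exact Finset.prod_congr rfl fun t _ => gaussianDensity_div_eq (hR φ hφ t) (a t) (hθ t)
    · intro t _
      have h1 : 0 < (θ t).2 := hθ t
      have h2 := ((hR φ hφ t).smul h1).det_pos.le
      have := gaussianDensity_nonneg (M.X t *ᵥ (θ t).1) (M.y t) h2
      positivity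
  rw [locScaleIntegral, setLIntegral_congr_fun hmeas hcongr, hset, volume_pi,
    Measure.restrict_pi_pi, lintegral_fin_prod hf, integratedLikelihood_eq,
    ← Finset.prod_mul_distrib, ENNReal.ofReal_prod_of_nonneg]
  · exact Finset.prod_congr rfl fun t _ => lintegral_level (hX t) (hy t) (hR φ hφ t) (ha t)
  · intro t _
    have h1 := Real.Gamma_pos_of_pos (ha t)
    have h2 := levelFactor_pos (hX t) (hy t) (M.expo a t) (hR φ hφ t)
    positivity

/-- Common mechanism for both priors: on the box I^(sd) the integrand dominates a multiple of ∏ 1/φ,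
so by Tonelli the mass is at least a positive multiple of a power of ∫_I dx/x = ∞. The power is
infinite because s and d are positive. -/
theorem posteriorMass_eq_top (hs : 0 < s) (hd : 0 < d) {a : Fin s → ℝ} {C : ℝ} (hC : 0 < C)
    (hint : ∀ φ : Fin s → Fin d → ℝ, (∀ t ℓ, 0 < φ t ℓ) →
      M.locScaleIntegral a φ = ENNReal.ofReal (C * M.integratedLikelihood a φ))
    {prior : (Fin s → Fin d → ℝ) → ℝ} (hprior : ∀ φ, (∀ t ℓ, 0 < φ t ℓ) → 0 ≤ prior φ)
    {I : Set ℝ} (hI : MeasurableSet I) (hpos : ∀ x ∈ I, 0 < x)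
    (hdiv : ¬ IntegrableOn (fun x : ℝ => x⁻¹) I) {c : ℝ} (hc : 0 < c)
    (hle : ∀ φ : Fin s → Fin d → ℝ, (∀ t ℓ, φ t ℓ ∈ I) →
      c * ∏ t, ∏ ℓ, (φ t ℓ)⁻¹ ≤ prior φ * M.integratedLikelihood a φ) :
    M.posteriorMass a prior = ⊤ := by
  let J : Set (Fin s → Fin d → ℝ) := Set.univ.pi fun _ => Set.univ.pi fun _ => I
  have hJ : MeasurableSet J := MeasurableSet.univ_pi fun _ => MeasurableSet.univ_pi fun _ => hI
  have hJI : ∀ φ ∈ J, ∀ t ℓ, φ t ℓ ∈ I := fun φ hφ t ℓ => hφ t trivial ℓ trivial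
  have hJpos : ∀ φ ∈ J, ∀ t ℓ, 0 < φ t ℓ := fun φ hφ t ℓ => hpos _ (hJI φ hφ t ℓ)
  have hinner : ∀ φ : Fin s → Fin d → ℝ, (∀ t ℓ, 0 < φ t ℓ) →
      ∫⁻ θ in M.locScaleSet, ENNReal.ofReal (M.likelihood θ φ *
        (prior φ / ∏ t, (θ t).2 ^ a t)) =
      ENNReal.ofReal (prior φ * (C * M.integratedLikelihood a φ)) := by
    intro φ hφ
    have h1 : ∀ θ : M.LocScale, ENNReal.ofReal (M.likelihood θ φ *
        (prior φ / ∏ t, (θ t).2 ^ a t)) = ENNReal.ofReal (prior φ) *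
          ENNReal.ofReal (M.likelihood θ φ / ∏ t, (θ t).2 ^ a t) := by
      intro θ
      rw [← ENNReal.ofReal_mul (hprior φ hφ)]
      congr 1
      ring
    simp only [h1]
    rw [lintegral_const_mul' _ _ ENNReal.ofReal_ne_top, ENNReal.ofReal_mul (hprior φ hφ),
      ← hint φ hφ, locScaleIntegral]
  have hlow : ∀ φ ∈ J, ENNReal.ofReal (C * c) * ∏ t, ∏ ℓ, ENNReal.ofReal (φ t ℓ)⁻¹ ≤
      ∫⁻ θ in M.locScaleSet, ENNReal.ofReal (M.likelihood θ φ *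
        (prior φ / ∏ t, (θ t).2 ^ a t)) := by
    intro φ hφ
    have hφ0 : ∀ t ℓ, 0 ≤ (φ t ℓ)⁻¹ := fun t ℓ => (inv_pos.2 (hJpos φ hφ t ℓ)).le
    have h1 : ∏ t, ∏ ℓ, ENNReal.ofReal (φ t ℓ)⁻¹ =
        ENNReal.ofReal (∏ t, ∏ ℓ, (φ t ℓ)⁻¹) := by
      rw [ENNReal.ofReal_prod_of_nonneg fun t _ => Finset.prod_nonneg fun ℓ _ => hφ0 t ℓ]
      exact Finset.prod_congr rfl fun t _ =>
        (ENNReal.ofReal_prod_of_nonneg fun ℓ _ => hφ0 t ℓ).symm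
    rw [hinner φ (hJpos φ hφ), h1, ← ENNReal.ofReal_mul (by positivity)]
    refine ENNReal.ofReal_le_ofReal ?_
    have := mul_le_mul_of_nonneg_left (hle φ (hJI φ hφ)) hC.le
    linarith
  have hsub : J ⊆ {φ : Fin s → Fin d → ℝ | ∀ t ℓ, 0 < φ t ℓ} := hJpos
  have htop : ∫⁻ φ in J, ∏ t, ∏ ℓ, ENNReal.ofReal (φ t ℓ)⁻¹ = ⊤ := by
    have hm1 : Measurable fun x : ℝ => ENNReal.ofReal x⁻¹ :=
      ENNReal.measurable_ofReal.comp measurable_inv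
    have hm : Measurable fun ψ : Fin d → ℝ => ∏ ℓ, ENNReal.ofReal (ψ ℓ)⁻¹ :=
      Finset.measurable_fun_prod _ fun ℓ _ => hm1.comp (measurable_pi_apply ℓ)
    have hd' : ∫⁻ ψ in (Set.univ.pi fun _ => I : Set (Fin d → ℝ)),
        ∏ ℓ, ENNReal.ofReal (ψ ℓ)⁻¹ = ⊤ := by
      rw [volume_pi, Measure.restrict_pi_pi,
        lintegral_fin_prod (f := fun _ x => ENNReal.ofReal x⁻¹) fun _ => hm1,
        setLIntegral_inv_eq_top hI hpos hdiv, Finset.prod_const]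
      simp [hd.ne']
    rw [volume_pi, Measure.restrict_pi_pi,
      lintegral_fin_prod (f := fun (_ : Fin s) (ψ : Fin d → ℝ) => ∏ ℓ, ENNReal.ofReal (ψ ℓ)⁻¹) fun _ => hm,
      hd', Finset.prod_const]
    simp [hs.ne']
  rw [posteriorMass, eq_top_iff]
  calc (⊤ : ENNReal) = ENNReal.ofReal (C * c) * ⊤ :=
        (ENNReal.mul_top (by simpa using mul_pos hC hc)).symm
    _ = ∫⁻ φ in J, ENNReal.ofReal (C * c) * ∏ t, ∏ ℓ, ENNReal.ofReal (φ t ℓ)⁻¹ := by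
        rw [lintegral_const_mul' _ _ ENNReal.ofReal_ne_top, htop]
    _ ≤ _ := setLIntegral_mono' hJ hlow
    _ ≤ _ := lintegral_mono_set hsub

end CokrigingModel

theorem mainTheorem5 {s d : ℕ} (hs : 0 < s) (hd : 0 < d) (M : CokrigingModel s d)
    (hX : ∀ t, LinearIndependent ℝ (M.X t).col)
    (hy : ∀ t, M.y t ∉ M.colSpace t)
    (ν ω : Fin s → Fin d → ℝ → ℝ)
    (D Dstar : (t : Fin s) → Fin d → Matrix (M.Row t) (M.Row t) ℝ)
    (B : (t : Fin s) → Fin d → ℝ → Matrix (M.Row t) (M.Row t) ℝ)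
    (hA : ∀ t ℓ, CorrelationAssumption (M.r t ℓ) (fun x : M.Row t => x.1 ℓ)
      (ν t ℓ) (ω t ℓ) (D t ℓ) (Dstar t ℓ) (B t ℓ)) :
    -- the closed form is the integrated likelihood, up to a constant factor
    (∀ a : Fin s → ℝ, (∀ t, 0 < M.expo a t) →
      ∃ C : ℝ, 0 < C ∧ ∀ φ : Fin s → Fin d → ℝ, (∀ t ℓ, 0 < φ t ℓ) →
        M.locScaleIntegral a φ = ENNReal.ofReal (C * M.integratedLikelihood a φ)) ∧
    -- (i)
    (∀ (a : Fin s → ℝ) (φ₀ : Fin s → Fin d → ℝ), (∀ t ℓ, 0 ≤ φ₀ t ℓ) → (∃ t ℓ, φ₀ t ℓ = 0) →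
      ∃ L₀ : ℝ, 0 < L₀ ∧
        Tendsto (M.integratedLikelihood a) (𝓝[{φ | ∀ t ℓ, 0 < φ t ℓ}] φ₀) (𝓝 L₀)) ∧
    -- (ii)
    (∀ a : Fin s → ℝ, (∀ t, M.y t ∉ M.colSpace t ⊔ Submodule.span ℝ {(1 : M.Row t → ℝ)}) →
      M.integratedLikelihood a
        =O[Filter.pi fun _ : Fin s => Filter.pi fun _ : Fin d => (atTop : Filter ℝ)]
        fun φ => ∏ t, (∑ ℓ, ν t ℓ (φ t ℓ)) ^ (a t - M.c t)) ∧
    -- the flat prior and the inverse-range prior give improper posteriors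
    M.posteriorMass (fun _ => 1) (fun _ => 1) = ⊤ ∧
    M.posteriorMass (fun _ => 1) (fun φ => ∏ t, ∏ ℓ, (φ t ℓ)⁻¹) = ⊤ := by

  have hR : ∀ φ : Fin s → Fin d → ℝ, (∀ t ℓ, 0 < φ t ℓ) → ∀ t, (M.R t (φ t)).PosDef :=
    fun φ hφ t => prodCorr_posDef hd (M.r_corr t) (fun ℓ => (hA t ℓ).injective) (hφ t)
  have hzero : ∀ a : Fin s → ℝ, (∀ t, 0 < M.expo a t) →
      ∃ C : ℝ, 0 < C ∧ ∀ φ : Fin s → Fin d → ℝ, (∀ t ℓ, 0 < φ t ℓ) →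
        M.locScaleIntegral a φ = ENNReal.ofReal (C * M.integratedLikelihood a φ) :=
    fun a ha => CokrigingModel.exists_locScaleIntegral_eq hX hy hR a ha
  -- No zero coordinate is needed for the limit; the case φ₀ = 0 is reused for the inverse-range
  -- prior.
  have hone : ∀ (a : Fin s → ℝ) (φ₀ : Fin s → Fin d → ℝ), (∀ t ℓ, 0 ≤ φ₀ t ℓ) →
      ∃ L₀ : ℝ, 0 < L₀ ∧
        Tendsto (M.integratedLikelihood a) (𝓝[{φ | ∀ t ℓ, 0 < φ t ℓ}] φ₀) (𝓝 L₀) := by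
    intro a φ₀ hφ₀
    choose R₀ hR₀ hlim using fun t => exists_tendsto_prodCorr (x := fun x : M.Row t => x.1) hd
      (M.r_corr t) (fun ℓ => (hA t ℓ).injective) (fun ℓ => (hA t ℓ).continuousOn)
      (fun ℓ => (hA t ℓ).tendsto_zero) (hφ₀ t)
    refine ⟨∏ t, levelFactor (M.X t) (M.y t) (M.expo a t) (R₀ t),
      Finset.prod_pos fun t _ => levelFactor_pos (hX t) (hy t) _ (hR₀ t), ?_⟩
    refine tendsto_finsetProd _ fun t _ => ?_
    have heval : Tendsto (fun φ : Fin s → Fin d → ℝ => φ t) (𝓝[{φ | ∀ t ℓ, 0 < φ t ℓ}] φ₀)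
        (𝓝[{φ | ∀ ℓ, 0 < φ ℓ}] (φ₀ t)) :=
      tendsto_nhdsWithin_iff.2 ⟨((continuous_apply t).tendsto φ₀).mono_left nhdsWithin_le_nhds, by
        filter_upwards [self_mem_nhdsWithin] with φ hφ using hφ t⟩
    exact (continuousAt_levelFactor (hX t) (hy t) (M.expo a t) (hR₀ t)).tendsto.comp
      ((hlim t).comp heval)
  -- y ∉ C(X) forces n > q, so the exponents are positive for a_t = 1 and the location-scale
  -- integral is finite.
  have hlt : ∀ t, Fintype.card (M.Col t) < Fintype.card (M.Row t) := by
    intro t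
    obtain ⟨m, K, hK⟩ := exists_isContrast (M.X t) (hX t)
    have hz := hK.ne_zero (hy t)
    rcases Nat.eq_zero_or_pos m with rfl | h
    · exact absurd (Subsingleton.elim _ 0) hz
    · have := hK.card_eq
      omega
  have hexpo : ∀ t, M.expo (fun _ => 1) t =
      ((Fintype.card (M.Row t) : ℝ) - Fintype.card (M.Col t)) / 2 := fun t => by
    rw [CokrigingModel.expo]
    ring
  obtain ⟨C, hC, hint⟩ := hzero (fun _ => 1) fun t => by
    have : (Fintype.card (M.Col t) : ℝ) < Fintype.card (M.Row t) := by exact_mod_cast hlt t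
    rw [hexpo]
    linarith
  refine ⟨hzero, fun a φ₀ hφ₀ _ => hone a φ₀ hφ₀, fun a hy' => ?_, ?_, ?_⟩
  · refine IsBigO.finsetProd fun t _ => ?_
    have h := (isBigO_levelFactor hd (hX t) (hy' t) (M.r_corr t) (hA t)
      (M.expo a t)).comp_tendsto (tendsto_eval_pi (fun _ : Fin s =>
        Filter.pi fun _ : Fin d => (atTop : Filter ℝ)) t)
    refine h.congr (fun φ => rfl) fun φ => ?_
    have he : M.expo a t - ((Fintype.card (M.Row t) : ℝ) - Fintype.card (M.Col t)) / 2 + 1 =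
        a t := by
      rw [CokrigingModel.expo]
      ring
    rw [he]
    rfl
  · choose c N hc hN using fun t => exists_prod_inv_le_levelFactor hd (hX t) (hy t)
      (M.r_corr t) (hA t)
    -- Flat prior: one threshold b beyond which the lower bounds of all levels hold.
    obtain ⟨b, hb⟩ := (Set.finite_range N).bddAbove
    refine CokrigingModel.posteriorMass_eq_top hs hd hC hint (fun _ _ => zero_le_one)
      (I := Set.Ioi (max b 0)) measurableSet_Ioi (fun x hx => (le_max_right b 0).trans_lt hx)
      not_integrableOn_Ioi_inv (c := ∏ t, c t) (Finset.prod_pos fun t _ => hc t) fun φ hφ => ?_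
    rw [one_mul, CokrigingModel.integratedLikelihood_eq, ← Finset.prod_mul_distrib]
    refine Finset.prod_le_prod (fun t _ => ?_) fun t _ => ?_
    · exact mul_nonneg (hc t).le (Finset.prod_nonneg fun ℓ _ =>
        (inv_pos.2 ((le_max_right b 0).trans_lt (hφ t ℓ))).le)
    · rw [hexpo]
      exact hN t _ fun ℓ => ((hb ⟨t, rfl⟩).trans (le_max_left b 0)).trans_lt (hφ t ℓ)
  -- Inverse-range prior: L^I exceeds L₀/2 on a sup-norm ball around 0, whose positive part is the
  -- box (0, ε)^(sd).
  · obtain ⟨L₀, hL₀, hlim⟩ := hone (fun _ => 1) 0 fun _ _ => le_rfl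
    obtain ⟨ε, hε, hball⟩ := Metric.mem_nhdsWithin_iff.1
      (hlim.eventually (lt_mem_nhds (half_lt_self hL₀)))
    refine CokrigingModel.posteriorMass_eq_top hs hd hC hint
      (fun φ hφ => Finset.prod_nonneg fun t _ => Finset.prod_nonneg fun ℓ _ =>
        (inv_pos.2 (hφ t ℓ)).le)
      (I := Set.Ioo 0 ε) measurableSet_Ioo (fun x hx => hx.1)
      (not_integrableOn_Ioo_inv hε) (half_pos hL₀) fun φ hφ => ?_
    have hmem : φ ∈ Metric.ball (0 : Fin s → Fin d → ℝ) ε := by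
      rw [Metric.mem_ball, dist_pi_lt_iff hε]
      refine fun t => (dist_pi_lt_iff hε).2 fun ℓ => ?_
      rw [Pi.zero_apply, Pi.zero_apply, dist_zero_right, Real.norm_of_nonneg (hφ t ℓ).1.le]
      exact (hφ t ℓ).2
    have h1 : L₀ / 2 < M.integratedLikelihood (fun _ => 1) φ :=
      hball ⟨hmem, fun t ℓ => (hφ t ℓ).1⟩
    rw [mul_comm]
    exact mul_le_mul_of_nonneg_left h1.le (Finset.prod_nonneg fun t _ =>
      Finset.prod_nonneg fun ℓ _ => (inv_pos.2 (hφ t ℓ).1).le)
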